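/- **Theorem (KL local-error framework).** There is an absolute constant $C>0$ such that the following holds. Let $L\in[\tfrac12,2]$ and let $N\ge 1$ be an integer. Then there are shifts $\eta_0,\dots,\eta_{N-1}\in[0,1]$ with $\eta_{N-1}=1$, depending only on $L$ and $N$, with the following property. Let $d\ge 0$, let $\widehat P$ and $P$ be Markov kernels on $\mathbb R^d$, let $\mu,\nu$ be probability measures on $\mathbb R^d$ with finite second moment, let $a_0,b:\mathbb R^d\to[0,\infty)$ and $a_1:\mathbb R^d\times\mathbb R^d\to[0,\infty)$ be measurable and $c,c'\ge0$, and assume that for all $x,y\in\mathbb R^d$ $$\mathcal W_2^2(\delta_x\widehat P,\delta_yP)\le L^2\|x-y\|^2+2a_1(x,y)\|x-y\|+a_0(x)^2,$$ $$\mathrm{KL}(\delta_xP\,\|\,\delta_yP)\le c\|x-y\|^2,\qquad \mathrm{KL}(\delta_x\widehat P\,\|\,\delta_yP)\le c'\|x-y\|^2+b(x)^2 .$$ Call a sequence of pairs $(\widehat X_n,Y_n')$, $0\le n<N$, a *shifted process* if, with $\widetilde Y_n:=(1-\eta_n)Y_n'+\eta_n\widehat X_n$: the pair $(\widehat X_0,Y_0')$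 is a $\mathcal W_2$-optimal coupling of $\mu$ and $\nu$; and for each $n$ with $n+1<N$, either $(\widehat X_{n+1},Y'_{n+1})$ is a $\mathcal W_2$-optimal coupling of $\mu\widehat P^{\,n+1}$ and $\mathrm{Law}(\widetilde Y_n)P$, or, conditionally on almost every value of $(\widehat X_n,Y_n')$, it is a $\mathcal W_2$-optimal coupling of $\widehat P(\widehat X_n,\cdot)$ and $P(\widetilde Y_n,\cdot)$. (Only the joint laws of the single pairs $(\widehat X_n,Y'_n)$ matter; in particular $\widehat X_n\sim\mu\widehat P^{\,n}$.) Then a shifted process exists, and for every shifted process $$\mathrm{KL}\bigl(\mu\widehat P^N\,\|\,\nu P^N\bigr)\le C\left\{(c+c')\left[\frac{L^{-1}-1}{L^{-N}-1}\,\mathcal W_2^2(\mu,\nu)+\bigl(((L-1)N)\vee\log\bar N\bigr)\,\bar a_0^{\,2}+\bar N\,\bar a_1^{\,2}\right]+\bar b^{\,2}\right\},$$ where $$\bar a_0=\sup_{0\le k<N}\|a_0(\widehat X_k)\|_{L^2},\quad \bar a_1=\sup_{0\le k<N}\|a_1(\widehat X_k,\widetilde Y_k)\|_{L^2},\quad \bar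 b=\max_{0\le n<N}\|b\|_{L^2(\mu\widehat P^{\,n})},\quad \bar N=N\wedge\frac1{(1-L)_+}\ \ (1/0=\infty),$$ and the coefficient of $\mathcal W_2^2(\mu,\nu)$ is read as $1/N$ when $L=1$. All quantities take values in $[0,\infty]$, with $0\cdot\infty=0$. -/

import Mathlib

open MeasureTheory ProbabilityTheory InformationTheory
open scoped ENNReal

/-- The Euclidean space `ℝᵈ`. -/
abbrev Euc (d : ℕ) : Type := EuclideanSpace ℝ (Fin d)

/-- The law `μ Kⁿ` after `n` steps of the Markov kernel `K` started from `μ`. -/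
noncomputable def iterLaw {d : ℕ} (μ : Measure (Euc d)) (K : Kernel (Euc d) (Euc d)) :
    ℕ → Measure (Euc d)
  | 0 => μ
  | n + 1 => (iterLaw μ K n).bind K

/-- `γ` is a coupling of `μ` and `ν`. -/
def IsCoupling {d : ℕ} (γ : Measure (Euc d × Euc d)) (μ ν : Measure (Euc d)) : Prop :=
  γ.map Prod.fst = μ ∧ γ.map Prod.snd = ν

/-- The quadratic transport cost `∫ ‖x - y‖² γ(dx, dy)`. -/
noncomputable def quadCost {d : ℕ} (γ : Measure (Euc d × Euc d)) : ℝ≥0∞ :=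
  ∫⁻ z, ‖z.1 - z.2‖ₑ ^ 2 ∂γ

/-- The `2`-Wasserstein distance, with values in `[0, ∞]`. -/
noncomputable def W2 {d : ℕ} (μ ν : Measure (Euc d)) : ℝ≥0∞ :=
  (⨅ (γ : Measure (Euc d × Euc d)) (_ : IsCoupling γ μ ν), quadCost γ) ^ (1 / 2 : ℝ)

/-- `γ` is a `W₂`-optimal coupling of `μ` and `ν`. -/
def IsOptimalCoupling {d : ℕ} (γ : Measure (Euc d × Euc d)) (μ ν : Measure (Euc d)) : Prop :=
  IsCoupling γ μ ν ∧ ∀ γ', IsCoupling γ' μ ν → quadCost γ ≤ quadCost γ'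

/-- The shifted point `ỹ = (1 - η) y' + η x̂` of a pair `z = (x̂, y')`. -/
noncomputable def shiftPt {d : ℕ} (η : ℝ) (z : Euc d × Euc d) : Euc d :=
  (1 - η) • z.2 + η • z.1

/-- The auxiliary interpolating process with shifts `η`, recorded through the joint laws
`γ n` of the pairs `(X̂ₙ, Y'ₙ)`, `0 ≤ n < N`.
The start is a `W₂`-optimal coupling of `μ` and `ν`. At each later step `Y'ₙ₊₁ ∼ P(Ỹₙ, ·)` with
`Ỹₙ = (1 - ηₙ) Y'ₙ + ηₙ X̂ₙ`, and the new pair is coupled through `W₂`: either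
`(X̂ₙ₊₁, Y'ₙ₊₁)` is an optimal coupling of its two marginal laws, or its conditional law given
`(X̂ₙ, Y'ₙ)` is an optimal coupling of `P̂(X̂ₙ, ·)` and `P(Ỹₙ, ·)`. -/
structure IsShiftedProcess {d : ℕ} (Phat P : Kernel (Euc d) (Euc d)) (μ ν : Measure (Euc d))
    (N : ℕ) (η : ℕ → ℝ) (γ : ℕ → Measure (Euc d × Euc d)) : Prop where
  init : IsOptimalCoupling (γ 0) μ ν
  step : ∀ n, n + 1 < N →
    IsOptimalCoupling (γ (n + 1)) (iterLaw μ Phat (n + 1))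
        (((γ n).map (shiftPt (η n))).bind P) ∨
      ∃ κ : Kernel (Euc d × Euc d) (Euc d × Euc d), IsMarkovKernel κ ∧
        (∀ᵐ z ∂(γ n), IsOptimalCoupling (κ z) (Phat z.1) (P (shiftPt (η n) z))) ∧
        γ (n + 1) = (γ n).bind κ

/-- `ā₀ = sup_{k < N} ‖a₀(X̂ₖ)‖_{L²}`; with `b` in place of `a₀` this is also `b̄`. -/
noncomputable def supL2 {d : ℕ} (Phat : Kernel (Euc d) (Euc d)) (μ : Measure (Euc d)) (N : ℕ)
    (f : Euc d → ℝ) : ℝ≥0∞ :=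
  ⨆ (k : ℕ) (_ : k < N), eLpNorm f 2 (iterLaw μ Phat k)

/-- `ā₁ = sup_{k < N} ‖a₁(X̂ₖ, Ỹₖ)‖_{L²}`. -/
noncomputable def supShiftedL2 {d : ℕ} (N : ℕ) (η : ℕ → ℝ) (γ : ℕ → Measure (Euc d × Euc d))
    (a₁ : Euc d → Euc d → ℝ) : ℝ≥0∞ :=
  ⨆ (k : ℕ) (_ : k < N), eLpNorm (fun z => a₁ z.1 (shiftPt (η k) z)) 2 (γ k)

/-- `N̄ = N ∧ 1 / (1 - L)₊`, with `1 / 0 = ∞`. -/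
noncomputable def barN (L : ℝ) (N : ℕ) : ℝ :=
  if L < 1 then min (N : ℝ) (1 / (1 - L)) else N

/-- `(L⁻¹ - 1) / (L⁻ᴺ - 1)`, extended by continuity by the value `1 / N` at `L = 1`. -/
noncomputable def wCoeff (L : ℝ) (N : ℕ) : ℝ :=
  if L = 1 then 1 / (N : ℝ) else (L⁻¹ - 1) / ((L ^ N)⁻¹ - 1)

open Filter Topology

/-! ### Existence of optimal couplings -/

/-! The divergence is paid for along an auxiliary chain started at `ν` and ending with law `μ P̂ᴺ`.
Before each step, Y' is pulled a fraction ηₙ of the way towards X̂ₙ and then moves by `P`; in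
divergence from the chain `ν Pⁿ` this costs at most c ηₙ² dₙ², where dₙ² is the mean square of X̂ₙ -
Y'ₙ. The last step moves from X̂ by `P̂`, which costs c' d² + b̄². These costs add up by the chain
rule and data processing (`klDiv_bind_le`, `klDiv_iterLaw_le`).

It remains to bound ∑ ηₙ² dₙ². The transport hypothesis and Cauchy–Schwarz give a recursion for dₙ
(`rmsDist_succ_sq_le`). When the pair is an optimal coupling of the marginal laws, this needs joint
convexity of W₂² (`exists_coupling_bind`). Instead of a measurable selection of couplings, optimal
couplings are averaged along an i.i.d. sample and a weak limit is taken.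

Put Sₘ = 1 + r + ⋯ + rᵐ⁻¹, ηₙ = 1 / S_{N-n} and eₙ = ηₙ dₙ. Since 1 - ηₙ = r S_{N-n-1} / S_{N-n},
the recursion becomes eₙ₊₁² ≤ (L r)² eₙ² + 2 r A₁ eₙ / S_{N-n-1} + A₀² / S_{N-n-1}², which is summed
in `sum_sq_le_of_shifted_recursion`. For L < 1 the choice r = L⁻¹ makes the factor (L r)² equal to
1, and the A₁ weights decay like Lᵐ, which produces N̄. For L ≥ 1 the choice r = L⁻² makes the
factor equal to r, so that the ratios weighting A₁ are all 1. -/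

lemma quadCost_eq_lintegral_ofReal {d : ℕ} (γ : Measure (Euc d × Euc d)) :
    quadCost γ = ∫⁻ z, ENNReal.ofReal (‖z.1 - z.2‖ ^ 2) ∂γ := by
  simp only [quadCost, ENNReal.ofReal_pow (norm_nonneg _), ofReal_norm]

lemma measurable_enorm_sub_sq {d : ℕ} :
    Measurable fun z : Euc d × Euc d => ‖z.1 - z.2‖ₑ ^ 2 := by fun_prop

/-- The quadratic cost is lower semicontinuous for weak convergence. -/
lemma quadCost_le_liminf {d : ℕ} {π : ℕ → ProbabilityMeasure (Euc d × Euc d)}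
    {γ : ProbabilityMeasure (Euc d × Euc d)} (h : Tendsto π atTop (𝓝 γ)) :
    quadCost (γ : Measure (Euc d × Euc d)) ≤
      atTop.liminf fun n => quadCost (π n : Measure (Euc d × Euc d)) := by
  simp only [quadCost_eq_lintegral_ofReal]
  exact lintegral_le_liminf_lintegral_of_forall_isOpen_measure_le_liminf_measure
    (by fun_prop) (fun z => sq_nonneg _)
    fun G hG => ProbabilityMeasure.le_liminf_measure_open_of_tendsto h hG

/-- A weakly convergent sequence of probability measures is tight. -/
lemma isTightMeasureSet_range_of_tendsto {X : Type*} [MeasurableSpace X] [PseudoMetricSpace X]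
    [BorelSpace X] [SecondCountableTopology X] [CompleteSpace X] [T2Space X]
    {μ : ℕ → ProbabilityMeasure X} {ν : ProbabilityMeasure X} (h : Tendsto μ atTop (𝓝 ν)) :
    IsTightMeasureSet {m : Measure X | ∃ n, (μ n : Measure X) = m} := by
  have hK : IsCompact (insert ν (Set.range μ)) := h.isCompact_insert_range
  have hc : IsCompact (closure (Set.range μ)) :=
    hK.closure_of_subset (Set.subset_insert _ _)
  refine (isTightMeasureSet_of_isCompact_closure hc).subset ?_
  rintro m ⟨n, rfl⟩
  exact ⟨μ n, ⟨n, rfl⟩, rfl⟩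

/-- If the marginals of a sequence of couplings converge weakly, then the limiting marginals have
a coupling whose cost is at most the limit of the costs. -/
lemma exists_coupling_of_tendsto {d : ℕ} {π : ℕ → ProbabilityMeasure (Euc d × Euc d)}
    {μ ν : ProbabilityMeasure (Euc d)}
    (hμ : Tendsto (fun n => (π n).map measurable_fst.aemeasurable) atTop (𝓝 μ))
    (hν : Tendsto (fun n => (π n).map measurable_snd.aemeasurable) atTop (𝓝 ν))
    {c : ℕ → ℝ≥0∞} {c₀ : ℝ≥0∞} (hc : ∀ n, quadCost (π n : Measure (Euc d × Euc d)) ≤ c n)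
    (hc₀ : Tendsto c atTop (𝓝 c₀)) :
    ∃ γ : Measure (Euc d × Euc d), IsCoupling γ μ ν ∧ quadCost γ ≤ c₀ := by
  -- Tight marginals make the couplings tight, so Prokhorov's theorem gives a convergent
  -- subsequence; the marginals pass to the limit by continuity of the projections.
  have htight : IsTightMeasureSet
      {m | ∃ p ∈ Set.range π, (p : Measure (Euc d × Euc d)) = m} := by
    refine IsTightMeasureSet.prodMk ?_ ?_
    · refine (isTightMeasureSet_range_of_tendsto hμ).subset ?_
      rintro _ ⟨_, ⟨_, ⟨n, rfl⟩, rfl⟩, rfl⟩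
      exact ⟨n, rfl⟩
    · refine (isTightMeasureSet_range_of_tendsto hν).subset ?_
      rintro _ ⟨_, ⟨_, ⟨n, rfl⟩, rfl⟩, rfl⟩
      exact ⟨n, rfl⟩
  obtain ⟨γ, -, φ, hφ, hlim⟩ := (isCompact_closure_of_isTightMeasureSet htight).tendsto_subseq
    fun n => subset_closure (Set.mem_range_self n)
  refine ⟨γ, ⟨?_, ?_⟩, ?_⟩
  · exact congrArg ProbabilityMeasure.toMeasure (tendsto_nhds_unique
      (ProbabilityMeasure.tendsto_map_of_tendsto_of_continuous _ _ hlim continuous_fst)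
      (hμ.comp hφ.tendsto_atTop))
  · exact congrArg ProbabilityMeasure.toMeasure (tendsto_nhds_unique
      (ProbabilityMeasure.tendsto_map_of_tendsto_of_continuous _ _ hlim continuous_snd)
      (hν.comp hφ.tendsto_atTop))
  · calc quadCost (γ : Measure (Euc d × Euc d))
        ≤ atTop.liminf fun n => quadCost (π (φ n) : Measure (Euc d × Euc d)) :=
          quadCost_le_liminf hlim
      _ ≤ atTop.liminf fun n => c (φ n) := liminf_le_liminf (Eventually.of_forall fun n => hc _)
      _ = c₀ := (hc₀.comp hφ.tendsto_atTop).liminf_eq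

lemma isCoupling_prod {d : ℕ} (μ ν : Measure (Euc d)) [IsProbabilityMeasure μ]
    [IsProbabilityMeasure ν] : IsCoupling (μ.prod ν) μ ν := by
  simp [IsCoupling, Measure.map_fst_prod, Measure.map_snd_prod]

lemma IsCoupling.isProbabilityMeasure {d : ℕ} {γ : Measure (Euc d × Euc d)} {μ ν : Measure (Euc d)}
    [IsProbabilityMeasure μ] (h : IsCoupling γ μ ν) : IsProbabilityMeasure γ := by
  refine ⟨?_⟩
  have := congrArg (fun m => m Set.univ) h.1
  simpa [Measure.map_apply measurable_fst] using this

/-- Any two probability measures on `ℝᵈ` have an optimal coupling. -/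
lemma exists_isOptimalCoupling {d : ℕ} (μ ν : Measure (Euc d)) [IsProbabilityMeasure μ]
    [IsProbabilityMeasure ν] : ∃ γ, IsOptimalCoupling γ μ ν := by
  set S : Set ℝ≥0∞ := quadCost '' {γ | IsCoupling γ μ ν} with hS
  have hne : S.Nonempty := ⟨_, _, isCoupling_prod μ ν, rfl⟩
  obtain ⟨c, -, hc, hcS⟩ := exists_seq_tendsto_sInf hne (OrderBot.bddBelow S)
  choose π hπ hπc using hcS
  have hp : ∀ n, IsProbabilityMeasure (π n) := fun n => (hπ n).isProbabilityMeasure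
  obtain ⟨γ, hγ, hle⟩ := exists_coupling_of_tendsto (π := fun n => ⟨π n, hp n⟩)
    (μ := ⟨μ, inferInstance⟩) (ν := ⟨ν, inferInstance⟩) (c := c) (c₀ := sInf S)
    (by
      refine tendsto_const_nhds.congr fun n => ?_
      exact Subtype.ext (hπ n).1.symm)
    (by
      refine tendsto_const_nhds.congr fun n => ?_
      exact Subtype.ext (hπ n).2.symm)
    (fun n => (hπc n).le) hc
  exact ⟨γ, hγ, fun γ' hγ' => hle.trans (sInf_le ⟨γ', hγ', rfl⟩)⟩

lemma W2_sq {d : ℕ} (μ ν : Measure (Euc d)) :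
    W2 μ ν ^ 2 = ⨅ (γ : Measure (Euc d × Euc d)) (_ : IsCoupling γ μ ν), quadCost γ := by
  rw [W2, ← ENNReal.rpow_natCast, ← ENNReal.rpow_mul]
  norm_num

lemma IsOptimalCoupling.quadCost_eq {d : ℕ} {γ : Measure (Euc d × Euc d)} {μ ν : Measure (Euc d)}
    (h : IsOptimalCoupling γ μ ν) : quadCost γ = W2 μ ν ^ 2 := by
  rw [W2_sq]
  exact le_antisymm (le_iInf₂ h.2) (iInf₂_le γ h.1)

/-! ### Mixtures of couplings -/

/-- The strong law of large numbers on the canonical space of i.i.d. sequences. -/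
lemma ae_tendsto_average {Z : Type*} [MeasurableSpace Z] (γ : Measure Z) [IsProbabilityMeasure γ]
    {g : Z → ℝ} (hg : Measurable g) (hint : Integrable g γ) :
    ∀ᵐ ω ∂(Measure.infinitePi fun _ : ℕ => γ),
      Tendsto (fun n : ℕ => (∑ i ∈ Finset.range n, g (ω i)) / n) atTop (𝓝 (∫ z, g z ∂γ)) := by
  have hmap : ∀ i : ℕ, (Measure.infinitePi fun _ : ℕ => γ).map (fun ω => ω i) = γ := fun i =>
    Measure.infinitePi_map_eval (fun _ : ℕ => γ) i
  have h := strong_law_ae_real (μ := Measure.infinitePi fun _ : ℕ => γ)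
    (fun i ω => g (ω i)) ?_ ?_ ?_
  · have h0 : ∫ ω, g (ω 0) ∂(Measure.infinitePi fun _ : ℕ => γ) = ∫ z, g z ∂γ := by
      conv_rhs => rw [← hmap 0]
      rw [integral_map (measurable_pi_apply 0).aemeasurable hg.aestronglyMeasurable]
    rwa [h0] at h
  · have : Integrable g ((Measure.infinitePi fun _ : ℕ => γ).map (fun ω => ω 0)) := by
      rwa [hmap 0]
    exact this.comp_measurable (measurable_pi_apply 0)
  · intro i j hij
    exact (iIndepFun_infinitePi (P := fun _ : ℕ => γ) (X := fun _ => g) fun _ => hg).indepFun hij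
  · intro i
    refine ⟨(hg.comp (measurable_pi_apply i)).aemeasurable,
      (hg.comp (measurable_pi_apply 0)).aemeasurable, ?_⟩
    change Measure.map (g ∘ fun ω : ℕ → Z => ω i) _ = Measure.map (g ∘ fun ω : ℕ → Z => ω 0) _
    rw [← Measure.map_map hg (measurable_pi_apply i), ← Measure.map_map hg (measurable_pi_apply 0),
      hmap, hmap]

/-- The average of the first `n + 1` measures of a sequence. -/
noncomputable def averageMeasure {X : Type*} [MeasurableSpace X] (π : ℕ → Measure X) (n : ℕ) :
    Measure X :=
  ((n + 1 : ℕ) : ℝ≥0∞)⁻¹ • ∑ i ∈ Finset.range (n + 1), π i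

lemma averageMeasure_apply {X : Type*} [MeasurableSpace X] (π : ℕ → Measure X) (n : ℕ)
    (s : Set X) :
    averageMeasure π n s = ((n + 1 : ℕ) : ℝ≥0∞)⁻¹ * ∑ i ∈ Finset.range (n + 1), π i s := by
  simp [averageMeasure]

lemma isProbabilityMeasure_averageMeasure {X : Type*} [MeasurableSpace X] {π : ℕ → Measure X}
    (h : ∀ i, IsProbabilityMeasure (π i)) (n : ℕ) :
    IsProbabilityMeasure (averageMeasure π n) := by
  refine ⟨?_⟩
  rw [averageMeasure_apply]
  simp only [measure_univ, Finset.sum_const, Finset.card_range, nsmul_eq_mul, mul_one]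
  exact ENNReal.inv_mul_cancel (by positivity) (ENNReal.natCast_ne_top _)

/-- `averageMeasure` as a probability measure. -/
noncomputable def averageProbability {X : Type*} [MeasurableSpace X] (π : ℕ → Measure X)
    (h : ∀ i, IsProbabilityMeasure (π i)) (n : ℕ) : ProbabilityMeasure X :=
  ⟨averageMeasure π n, isProbabilityMeasure_averageMeasure h n⟩

lemma map_averageMeasure {X Y : Type*} [MeasurableSpace X] [MeasurableSpace Y]
    (π : ℕ → Measure X) (n : ℕ) {f : X → Y} (hf : Measurable f) :
    (averageMeasure π n).map f = averageMeasure (fun i => (π i).map f) n := by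
  ext s hs
  simp [Measure.map_apply hf hs, averageMeasure_apply]

lemma lintegral_averageMeasure {X : Type*} [MeasurableSpace X] (π : ℕ → Measure X) (n : ℕ)
    (f : X → ℝ≥0∞) :
    ∫⁻ x, f x ∂(averageMeasure π n) =
      ((n + 1 : ℕ) : ℝ≥0∞)⁻¹ * ∑ i ∈ Finset.range (n + 1), ∫⁻ x, f x ∂(π i) := by
  simp [averageMeasure, lintegral_smul_measure]

/-- A second countable space has a countable `π`-system of open sets that is a basis. -/
lemma exists_countable_isPiSystem_basis (X : Type*) [TopologicalSpace X]
    [SecondCountableTopology X] :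
    ∃ S : Set (Set X), S.Countable ∧ IsPiSystem S ∧ (∀ s ∈ S, IsOpen s) ∧
      ∀ u : Set X, IsOpen u → ∀ x ∈ u, ∃ s ∈ S, s ∈ 𝓝 x ∧ s ⊆ u := by
  have hB := TopologicalSpace.isBasis_countableBasis X
  have hBc := TopologicalSpace.countable_countableBasis X
  refine ⟨(fun F => ⋂₀ F) '' {F : Set (Set X) | F.Finite ∧ F ⊆ TopologicalSpace.countableBasis X},
    (Set.countable_ofPred_finite_subset hBc).image _, ?_, ?_, ?_⟩
  · rintro _ ⟨F, ⟨hF, hFB⟩, rfl⟩ _ ⟨G, ⟨hG, hGB⟩, rfl⟩ -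
    exact ⟨F ∪ G, ⟨hF.union hG, Set.union_subset hFB hGB⟩, Set.sInter_union F G⟩
  · rintro _ ⟨F, ⟨hF, hFB⟩, rfl⟩
    exact hF.isOpen_sInter fun t ht => hB.isOpen (hFB ht)
  · intro u hu x hx
    obtain ⟨v, hv, hxv, hvu⟩ := hB.exists_subset_of_mem_open hx hu
    exact ⟨v, ⟨{v}, ⟨Set.finite_singleton v, by simpa using hv⟩, by simp⟩,
      (hB.isOpen hv).mem_nhds hxv, hvu⟩

/-- Averages of a Markov kernel along almost every i.i.d. sequence converge weakly to the
mixture. -/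
lemma ae_tendsto_averageMeasure {Z X : Type*} [MeasurableSpace Z] [MeasurableSpace X]
    [PseudoMetricSpace X] [BorelSpace X] [SecondCountableTopology X]
    (γ : Measure Z) [IsProbabilityMeasure γ] (A : Kernel Z X) [IsMarkovKernel A] :
    ∀ᵐ ω ∂(Measure.infinitePi fun _ : ℕ => γ),
      Tendsto (averageProbability (fun i => A (ω i)) fun _ => inferInstance) atTop
         (𝓝 (⟨γ.bind A, inferInstance⟩ : ProbabilityMeasure X)) := by
  obtain ⟨S, hSc, hSpi, hSo, hSb⟩ := exists_countable_isPiSystem_basis X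
  have hall : ∀ᵐ ω ∂(Measure.infinitePi fun _ : ℕ => γ), ∀ s ∈ S,
      Tendsto (fun n : ℕ => (∑ i ∈ Finset.range n, (A (ω i) s).toReal) / n) atTop
        (𝓝 (∫ z, (A z s).toReal ∂γ)) := by
    rw [ae_ball_iff hSc]
    intro s hs
    have hm : Measurable fun z => (A z s).toReal :=
      (A.measurable_coe (hSo s hs).measurableSet).ennreal_toReal
    refine ae_tendsto_average γ hm (Integrable.of_bound hm.aestronglyMeasurable 1 ?_)
    refine Eventually.of_forall fun z => ?_
    rw [Real.norm_of_nonneg ENNReal.toReal_nonneg]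
    exact ENNReal.toReal_le_of_le_ofReal zero_le_one (by simpa using prob_le_one)
  filter_upwards [hall] with ω hω
  refine hSpi.tendsto_probabilityMeasure_of_tendsto_of_mem
    (fun s hs => (hSo s hs).measurableSet) hSb fun s hs => ?_
  have hms := (hSo s hs).measurableSet
  rw [← NNReal.tendsto_coe]
  have h1 := (tendsto_add_atTop_iff_nat 1).2 (hω s hs)
  have h2 : ∫ z, (A z s).toReal ∂γ = ((γ.bind A) s).toReal := by
    rw [Measure.bind_apply hms A.aemeasurable, integral_toReal (A.measurable_coe hms).aemeasurable
      (Eventually.of_forall fun z => measure_lt_top _ _)]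
  rw [h2] at h1
  refine h1.congr fun n => ?_
  change _ = (averageMeasure (fun i => A (ω i)) n s).toReal
  rw [averageMeasure_apply, ENNReal.toReal_mul, ENNReal.toReal_sum (fun i _ => measure_ne_top _ _)]
  rw [ENNReal.toReal_inv, ENNReal.toReal_natCast, div_eq_inv_mul]

/-- Joint convexity of the squared Wasserstein distance along mixtures. -/
lemma exists_coupling_bind {Z : Type*} [MeasurableSpace Z] {d : ℕ} (γ : Measure Z)
    [IsProbabilityMeasure γ] (A B : Kernel Z (Euc d)) [IsMarkovKernel A] [IsMarkovKernel B]
    {f : Z → ℝ} (hf : Measurable f) (hf0 : ∀ z, 0 ≤ f z)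
    (h : ∀ z, W2 (A z) (B z) ^ 2 ≤ ENNReal.ofReal (f z)) :
    ∃ π, IsCoupling π (γ.bind A) (γ.bind B) ∧ quadCost π ≤ ∫⁻ z, ENNReal.ofReal (f z) ∂γ := by
  -- Without integrability the bound is ∞ and the product coupling suffices; with it, the law of
  -- large numbers applies to `f`.
  by_cases hint : Integrable f γ
  swap
  · refine ⟨_, isCoupling_prod _ _, ?_⟩
    have : ∫⁻ z, ENNReal.ofReal (f z) ∂γ = ∞ := by
      by_contra hne
      exact hint ((lintegral_ofReal_ne_top_iff_integrable hf.aestronglyMeasurable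
        (Eventually.of_forall hf0)).1 hne)
    simp [this]
  -- This choice need not be measurable in `z`: it is only evaluated along one sample sequence `ω`.
  choose π hπ using fun z => exists_isOptimalCoupling (A z) (B z)
  have hp : ∀ z, IsProbabilityMeasure (π z) := fun z => (hπ z).1.isProbabilityMeasure
  obtain ⟨ω, hA, hB, hω⟩ := ((ae_tendsto_averageMeasure γ A).and
    ((ae_tendsto_averageMeasure γ B).and (ae_tendsto_average γ hf hint))).exists
  refine exists_coupling_of_tendsto
    (μ := ⟨γ.bind A, inferInstance⟩) (ν := ⟨γ.bind B, inferInstance⟩)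
    (π := averageProbability (fun i => π (ω i)) fun i => hp _)
    (c := fun n => ENNReal.ofReal ((∑ i ∈ Finset.range (n + 1), f (ω i)) / ((n + 1 : ℕ) : ℝ)))
    ?_ ?_ ?_ ?_
  · refine hA.congr fun n => Subtype.ext ?_
    change _ = (averageMeasure (fun i => π (ω i)) n).map Prod.fst
    rw [map_averageMeasure _ _ measurable_fst]
    simp only [(hπ _).1.1]
    rfl
  · refine hB.congr fun n => Subtype.ext ?_
    change _ = (averageMeasure (fun i => π (ω i)) n).map Prod.snd
    rw [map_averageMeasure _ _ measurable_snd]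
    simp only [(hπ _).1.2]
    rfl
  · intro n
    change ∫⁻ z, ‖z.1 - z.2‖ₑ ^ 2 ∂(averageMeasure (fun i => π (ω i)) n) ≤ _
    rw [lintegral_averageMeasure, div_eq_inv_mul, ENNReal.ofReal_mul (by positivity),
      ENNReal.ofReal_inv_of_pos (by positivity), ENNReal.ofReal_natCast,
      ENNReal.ofReal_sum_of_nonneg fun i _ => hf0 _]
    gcongr with i _
    exact ((hπ (ω i)).quadCost_eq.le).trans (h (ω i))
  · rw [← ofReal_integral_eq_lintegral_ofReal hint (Eventually.of_forall hf0)]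
    exact (ENNReal.continuous_ofReal.tendsto _).comp ((tendsto_add_atTop_iff_nat 1).2 hω)

/-! ### Kullback-Leibler divergence of mixtures -/

/-- The conditional Kullback-Leibler divergence is the average of the divergences of the
kernels. -/
lemma klDiv_compProd_right {Z E : Type*} [MeasurableSpace Z] [MeasurableSpace E]
    [MeasurableSpace.CountableOrCountablyGenerated Z E]
    (γ : Measure Z) [IsFiniteMeasure γ] (κ η : Kernel Z E) [IsFiniteKernel κ] [IsFiniteKernel η]
    (hac : ∀ z, κ z ≪ η z) :
    klDiv (γ ⊗ₘ κ) (γ ⊗ₘ η) = ∫⁻ z, klDiv (κ z) (η z) ∂γ := by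
  -- One jointly measurable density serves both sides: it is the density of `γ ⊗ₘ κ` and, for each
  -- `z`, almost everywhere that of `κ z`.
  have hf : Measurable fun p : Z × E => Kernel.rnDeriv κ η p.1 p.2 := Kernel.measurable_rnDeriv κ η
  have hker : ∀ z, κ z = (η z).withDensity (Kernel.rnDeriv κ η z) := fun z => by
    rw [withDensity_congr_ae Kernel.rnDeriv_eq_rnDeriv_measure, Measure.withDensity_rnDeriv_eq _ _
      (hac z)]
  have hdens : γ ⊗ₘ κ = (γ ⊗ₘ η).withDensity fun p => Kernel.rnDeriv κ η p.1 p.2 := by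
    ext s hs
    rw [Measure.compProd_apply hs, withDensity_apply _ hs, ← lintegral_indicator hs,
      Measure.lintegral_compProd (hf.indicator hs)]
    refine lintegral_congr fun z => ?_
    rw [hker z, withDensity_apply _ (measurable_prodMk_left hs),
      ← lintegral_indicator (measurable_prodMk_left hs)]
    rfl
  have hrn : (γ ⊗ₘ κ).rnDeriv (γ ⊗ₘ η) =ᵐ[γ ⊗ₘ η] fun p => Kernel.rnDeriv κ η p.1 p.2 := by
    conv_lhs => rw [hdens]
    exact Measure.rnDeriv_withDensity _ hf
  rw [klDiv_eq_lintegral_klFun_of_ac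
    (Measure.AbsolutelyContinuous.compProd_right (Eventually.of_forall hac))]
  rw [lintegral_congr_ae (hrn.mono fun p hp => by rw [hp]),
    Measure.lintegral_compProd (by fun_prop)]
  refine lintegral_congr fun z => ?_
  rw [klDiv_eq_lintegral_klFun_of_ac (hac z)]
  refine lintegral_congr_ae ?_
  filter_upwards [Kernel.rnDeriv_eq_rnDeriv_measure (κ := κ) (η := η) (a := z)] with x hx
  rw [hx]

/-- Shifted chain rule for one step: if the pair `(y, x)` has law `γ`, the divergence after a step
which may depend on `x` is controlled by the divergence of the `y`-marginal and the average
divergence of the kernels. -/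
lemma klDiv_bind_le {Y X E : Type*} [MeasurableSpace Y] [MeasurableSpace X] [MeasurableSpace E]
    [StandardBorelSpace X] [Nonempty X] [MeasurableSpace.CountablyGenerated E]
    (γ : Measure (Y × X)) [IsProbabilityMeasure γ] (ρ : Measure Y) [IsProbabilityMeasure ρ]
    (κ : Kernel (Y × X) E) [IsMarkovKernel κ] (P : Kernel Y E) [IsMarkovKernel P]
    (hac : ∀ z, κ z ≪ P z.1) :
    klDiv (γ.bind κ) (ρ.bind P) ≤ klDiv (γ.map Prod.fst) ρ + ∫⁻ z, klDiv (κ z) (P z.1) ∂γ := by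
  set P' : Kernel (Y × X) E := P.comap Prod.fst measurable_fst with hP'
  have hγ : γ.fst ⊗ₘ γ.condKernel = γ := γ.disintegrate γ.condKernel
  have h1 : γ.bind κ = (γ ⊗ₘ κ).map Prod.snd := (Measure.snd_compProd γ κ).symm
  have h2 : ρ.bind P = ((ρ ⊗ₘ γ.condKernel) ⊗ₘ P').map Prod.snd := by
    have : (ρ ⊗ₘ γ.condKernel).bind P' = ρ.bind P := by
      conv_rhs => rw [← Measure.fst_compProd ρ γ.condKernel]
      ext s hs
      rw [Measure.bind_apply hs P'.aemeasurable, Measure.bind_apply hs P.aemeasurable,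
        Measure.fst, lintegral_map (P.measurable_coe hs) measurable_fst]
      rfl
    rw [← this]
    exact (Measure.snd_compProd _ _).symm
  -- The reference measure is given the conditional law of `x` given `y` from `γ`. This leaves its
  -- image `ρ.bind P` unchanged, as `P'` ignores `x`, and reduces the divergence of the pairs to
  -- that of their `y`-marginals.
  calc klDiv (γ.bind κ) (ρ.bind P)
      ≤ klDiv (γ ⊗ₘ κ) ((ρ ⊗ₘ γ.condKernel) ⊗ₘ P') := by
        rw [h1, h2]; exact klDiv_map_le _ _ measurable_snd
    _ = klDiv γ (ρ ⊗ₘ γ.condKernel) + klDiv (γ ⊗ₘ κ) (γ ⊗ₘ P') := klDiv_compProd_eq_add ..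
    _ = klDiv (γ.map Prod.fst) ρ + ∫⁻ z, klDiv (κ z) (P z.1) ∂γ := by
        rw [klDiv_compProd_right γ κ P' hac]
        conv_lhs => enter [1, 1]; rw [← hγ]
        rw [klDiv_compProd_left]
        rfl

/-- The law `μ Kⁿ` is a probability measure. -/
instance isProbabilityMeasure_iterLaw {d : ℕ} (μ : Measure (Euc d)) [IsProbabilityMeasure μ]
    (K : Kernel (Euc d) (Euc d)) [IsMarkovKernel K] (n : ℕ) :
    IsProbabilityMeasure (iterLaw μ K n) := by
  induction n with
  | zero => assumption
  | succ n ih => exact inferInstanceAs (IsProbabilityMeasure ((iterLaw μ K n).bind K))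

lemma absolutelyContinuous_of_klDiv_ne_top {X : Type*} [MeasurableSpace X] {μ ν : Measure X}
    (h : klDiv μ ν ≠ ∞) : μ ≪ ν := (klDiv_ne_top_iff.1 h).1

/-- The one-step estimate for pairs `(x̂, y')` on `ℝᵈ`. -/
lemma klDiv_bind_le_of_pair {d : ℕ} (γ : Measure (Euc d × Euc d)) [IsProbabilityMeasure γ]
    (ρ : Measure (Euc d)) [IsProbabilityMeasure ρ] (κ : Kernel (Euc d × Euc d) (Euc d))
    [IsMarkovKernel κ] (P : Kernel (Euc d) (Euc d)) [IsMarkovKernel P]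
    {g : Euc d × Euc d → ℝ} (hg : ∀ z, klDiv (κ z) (P z.2) ≤ ENNReal.ofReal (g z)) :
    klDiv (γ.bind κ) (ρ.bind P) ≤ klDiv (γ.map Prod.snd) ρ + ∫⁻ z, ENNReal.ofReal (g z) ∂γ := by
  have hs : Measurable (Prod.swap : Euc d × Euc d → Euc d × Euc d) := measurable_swap
  have hac : ∀ z : Euc d × Euc d, κ z ≪ P z.2 := fun z =>
    absolutelyContinuous_of_klDiv_ne_top (ne_top_of_le_ne_top ENNReal.ofReal_ne_top (hg z))
  have : IsProbabilityMeasure (γ.map Prod.swap) :=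
    Measure.isProbabilityMeasure_map hs.aemeasurable
  have h := klDiv_bind_le (γ.map Prod.swap) ρ (κ.comap Prod.swap hs) P fun z => hac z.swap
  have hbind : (γ.map Prod.swap).bind (κ.comap Prod.swap hs) = γ.bind κ := by
    ext s hs'
    rw [Measure.bind_apply hs' (Kernel.aemeasurable _), Measure.bind_apply hs' κ.aemeasurable,
      lintegral_map (Kernel.measurable_coe _ hs') hs]
    rfl
  rw [hbind, Measure.map_map measurable_fst hs] at h
  refine h.trans (add_le_add le_rfl ?_)
  calc ∫⁻ z, klDiv ((κ.comap Prod.swap hs) z) (P z.1) ∂(γ.map Prod.swap)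
      = ∫⁻ z, klDiv (κ z) (P z.2) ∂γ :=
        -- Changing variables along a measurable equivalence requires no measurability of the
        -- integrand `klDiv`.
        lintegral_map_equiv (fun z => klDiv ((κ.comap Prod.swap hs) z) (P z.1))
          (MeasurableEquiv.prodComm (α := Euc d) (β := Euc d))
    _ ≤ _ := lintegral_mono hg

/-! ### Laws along a shifted process -/

lemma measurable_shiftPt {d : ℕ} (η : ℝ) : Measurable (shiftPt (d := d) η) := by
  unfold shiftPt
  fun_prop

lemma fst_sub_shiftPt {d : ℕ} (η : ℝ) (z : Euc d × Euc d) :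
    z.1 - shiftPt η z = (1 - η) • (z.1 - z.2) := by
  simp only [shiftPt]
  module

lemma shiftPt_sub_snd {d : ℕ} (η : ℝ) (z : Euc d × Euc d) :
    shiftPt η z - z.2 = η • (z.1 - z.2) := by
  simp only [shiftPt]
  module

/-- The kernel `z ↦ P(ỹ, ·)` with `ỹ` the shifted point of the pair `z`. -/
noncomputable def shiftKernel {d : ℕ} (P : Kernel (Euc d) (Euc d)) (η : ℝ) :
    Kernel (Euc d × Euc d) (Euc d) :=
  P.comap (shiftPt η) (measurable_shiftPt η)

instance isMarkovKernel_shiftKernel {d : ℕ} (P : Kernel (Euc d) (Euc d)) [IsMarkovKernel P]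
    (η : ℝ) : IsMarkovKernel (shiftKernel P η) := by
  unfold shiftKernel; infer_instance

/-- The kernel `z ↦ K(x̂, ·)` with `x̂` the first point of the pair `z`. -/
noncomputable def firstKernel {d : ℕ} (K : Kernel (Euc d) (Euc d)) :
    Kernel (Euc d × Euc d) (Euc d) :=
  K.comap Prod.fst measurable_fst

instance isMarkovKernel_firstKernel {d : ℕ} (K : Kernel (Euc d) (Euc d)) [IsMarkovKernel K] :
    IsMarkovKernel (firstKernel K) := by
  unfold firstKernel; infer_instance

lemma map_bind_eq_bind_comap {X Y E : Type*} [MeasurableSpace X] [MeasurableSpace Y]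
    [MeasurableSpace E] (γ : Measure X) (P : Kernel Y E) {f : X → Y} (hf : Measurable f) :
    (γ.map f).bind P = γ.bind (P.comap f hf) := by
  ext s hs
  rw [Measure.bind_apply hs P.aemeasurable, Measure.bind_apply hs (Kernel.aemeasurable _),
    lintegral_map (P.measurable_coe hs) hf]
  rfl

lemma bind_congr_ae {X E : Type*} [MeasurableSpace X] [MeasurableSpace E] {γ : Measure X}
    {κ η : Kernel X E} (h : ∀ᵐ x ∂γ, κ x = η x) : γ.bind κ = γ.bind η := by
  ext s hs
  rw [Measure.bind_apply hs κ.aemeasurable, Measure.bind_apply hs η.aemeasurable]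
  exact lintegral_congr_ae (h.mono fun x hx => by simp only [hx])

lemma map_bind_kernel {X E F : Type*} [MeasurableSpace X] [MeasurableSpace E] [MeasurableSpace F]
    (γ : Measure X) (κ : Kernel X E) {f : E → F} (hf : Measurable f) :
    (γ.bind κ).map f = γ.bind (κ.map f) := by
  ext s hs
  rw [Measure.map_apply hf hs, Measure.bind_apply (hf hs) κ.aemeasurable,
    Measure.bind_apply hs (Kernel.aemeasurable _)]
  exact lintegral_congr fun x => by rw [Kernel.map_apply' _ hf _ hs]

section ShiftedLaws

variable {d : ℕ} {Phat P : Kernel (Euc d) (Euc d)} {μ ν : Measure (Euc d)} {N : ℕ} {η : ℕ → ℝ} {γ : ℕ → Measure (Euc d × Euc d)}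

/-- One step of a shifted process couples `γₙ P̂` and `γₙ P(ỹ, ·)`. -/
lemma isCoupling_step (h : IsShiftedProcess Phat P μ ν N η γ) {n : ℕ} (hn : n + 1 < N)
    (hfst : (γ n).map Prod.fst = iterLaw μ Phat n) :
    IsCoupling (γ (n + 1)) (iterLaw μ Phat (n + 1)) ((γ n).bind (shiftKernel P (η n))) := by
  -- Both kinds of coupling have the same marginals, so the divergence estimates need not
  -- distinguish them.
  rcases h.step n hn with hopt | ⟨κ, hκ, hcond, hγ⟩
  · have := hopt.1
    rwa [map_bind_eq_bind_comap _ P (measurable_shiftPt (η n))] at this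
  · rw [hγ]
    constructor
    · rw [map_bind_kernel _ _ measurable_fst]
      change _ = (iterLaw μ Phat n).bind Phat
      rw [← hfst, map_bind_eq_bind_comap _ Phat measurable_fst]
      refine bind_congr_ae (hcond.mono fun z hz => ?_)
      rw [Kernel.map_apply _ measurable_fst]
      exact hz.1.1
    · rw [map_bind_kernel _ _ measurable_snd]
      refine bind_congr_ae (hcond.mono fun z hz => ?_)
      rw [Kernel.map_apply _ measurable_snd]
      exact hz.1.2

lemma map_fst_eq_iterLaw (h : IsShiftedProcess Phat P μ ν N η γ) :
    ∀ n, n < N → (γ n).map Prod.fst = iterLaw μ Phat n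
  | 0, _ => h.init.1.1
  | n + 1, hn => (isCoupling_step h hn (map_fst_eq_iterLaw h n (by omega))).1

lemma map_snd_succ (h : IsShiftedProcess Phat P μ ν N η γ) {n : ℕ} (hn : n + 1 < N) :
    (γ (n + 1)).map Prod.snd = (γ n).bind (shiftKernel P (η n)) :=
  (isCoupling_step h hn (map_fst_eq_iterLaw h n (by omega))).2

variable [IsMarkovKernel Phat] [IsProbabilityMeasure μ]

lemma isProbabilityMeasure_shifted (h : IsShiftedProcess Phat P μ ν N η γ) {n : ℕ} (hn : n < N) :
    IsProbabilityMeasure (γ n) :=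
  IsCoupling.isProbabilityMeasure (μ := iterLaw μ Phat n) (ν := (γ n).map Prod.snd)
    ⟨map_fst_eq_iterLaw h n hn, rfl⟩

/-- A shifted process exists for every choice of the shifts. -/
lemma exists_isShiftedProcess (Phat P : Kernel (Euc d) (Euc d)) [IsMarkovKernel Phat]
    [IsMarkovKernel P] (μ ν : Measure (Euc d)) [IsProbabilityMeasure μ] [IsProbabilityMeasure ν]
    (N : ℕ) (η : ℕ → ℝ) : ∃ γ, IsShiftedProcess Phat P μ ν N η γ := by
  have hex : ∀ (n : ℕ) (p : ProbabilityMeasure (Euc d × Euc d)),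
      ∃ q : ProbabilityMeasure (Euc d × Euc d),
        IsOptimalCoupling (q : Measure (Euc d × Euc d)) (iterLaw μ Phat (n + 1))
          (((p : Measure (Euc d × Euc d)).map (shiftPt (η n))).bind P) := fun n p => by
    have : IsProbabilityMeasure ((p : Measure (Euc d × Euc d)).map (shiftPt (η n))) :=
      Measure.isProbabilityMeasure_map (measurable_shiftPt _).aemeasurable
    obtain ⟨q, hq⟩ := exists_isOptimalCoupling (iterLaw μ Phat (n + 1))
      (((p : Measure (Euc d × Euc d)).map (shiftPt (η n))).bind P)
    exact ⟨⟨q, hq.1.isProbabilityMeasure⟩, hq⟩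
  choose F hF using hex
  obtain ⟨q₀, hq₀⟩ := exists_isOptimalCoupling μ ν
  let γ : ℕ → ProbabilityMeasure (Euc d × Euc d) := fun n =>
    Nat.rec ⟨q₀, hq₀.1.isProbabilityMeasure⟩ (fun n p => F n p) n
  let γ' : ℕ → Measure (Euc d × Euc d) := fun n => (γ n).toMeasure
  exact ⟨γ', hq₀, fun n _ => Or.inl (hF n (γ n))⟩

/-! ### Transport costs and mean square distances along the process -/

variable [IsMarkovKernel P]

/-- One step of a shifted process is at least as cheap as the conditional optimal coupling. -/
lemma quadCost_step_le (h : IsShiftedProcess Phat P μ ν N η γ) {n : ℕ} (hn : n + 1 < N)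
    {f : Euc d → Euc d → ℝ} (hf : Measurable (Function.uncurry f)) (hf0 : ∀ x y, 0 ≤ f x y)
    (hW : ∀ x y, W2 (Phat x) (P y) ^ 2 ≤ ENNReal.ofReal (f x y)) :
    quadCost (γ (n + 1)) ≤ ∫⁻ z, ENNReal.ofReal (f z.1 (shiftPt (η n) z)) ∂(γ n) := by
  have hp := isProbabilityMeasure_shifted h (show n < N by omega)
  -- A global optimal coupling is compared with the mixture from `exists_coupling_bind`; a
  -- conditional one has its cost integrated directly.
  rcases h.step n hn with hopt | ⟨κ, hκ, hcond, hγ⟩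
  · obtain ⟨π, hπ, hle⟩ := exists_coupling_bind (γ n) (firstKernel Phat)
      (shiftKernel P (η n)) (f := fun z => f z.1 (shiftPt (η n) z))
      (hf.comp (measurable_fst.prodMk (measurable_shiftPt _))) (fun z => hf0 _ _)
      (fun z => hW _ _)
    refine (hopt.2 π ?_).trans hle
    rw [map_bind_eq_bind_comap _ P (measurable_shiftPt (η n))]
    change IsCoupling π ((iterLaw μ Phat n).bind Phat) _
    rw [← map_fst_eq_iterLaw h n (by omega), map_bind_eq_bind_comap _ Phat measurable_fst]
    exact hπ
  · rw [hγ, quadCost, Measure.lintegral_bind κ.aemeasurable measurable_enorm_sub_sq.aemeasurable]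
    refine lintegral_mono_ae (hcond.mono fun z hz => ?_)
    exact (hz.quadCost_eq.le).trans (hW _ _)

lemma eLpNorm_two_sq {X F : Type*} [MeasurableSpace X] [NormedAddCommGroup F] (γ : Measure X)
    (f : X → F) : eLpNorm f 2 γ ^ 2 = ∫⁻ x, ‖f x‖ₑ ^ 2 ∂γ := by
  rw [eLpNorm_eq_lintegral_rpow_enorm_toReal two_ne_zero ENNReal.ofNat_ne_top,
    ← ENNReal.rpow_natCast, ← ENNReal.rpow_mul]
  simp

/-- The root mean square distance of a pair with law `γ`. -/
noncomputable def rmsDist (γ : Measure (Euc d × Euc d)) : ℝ≥0∞ :=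
  eLpNorm (fun z : Euc d × Euc d => z.1 - z.2) 2 γ

lemma rmsDist_sq (γ : Measure (Euc d × Euc d)) : rmsDist γ ^ 2 = quadCost γ :=
  eLpNorm_two_sq γ _

lemma lintegral_enorm_mul_le {X F G : Type*} [MeasurableSpace X] [NormedAddCommGroup F]
    [NormedAddCommGroup G] (γ : Measure X) {f : X → F} {g : X → G} (hf : AEStronglyMeasurable f γ)
    (hg : AEStronglyMeasurable g γ) :
    ∫⁻ x, ‖f x‖ₑ * ‖g x‖ₑ ∂γ ≤ eLpNorm f 2 γ * eLpNorm g 2 γ := by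
  have h := ENNReal.lintegral_mul_le_Lp_mul_Lq γ Real.HolderConjugate.two_two
    hf.enorm hg.enorm
  simpa [eLpNorm_eq_lintegral_rpow_enorm_toReal] using h

lemma eLpNorm_le_supShiftedL2 {a₁ : Euc d → Euc d → ℝ} {n : ℕ} (hn : n < N) :
    eLpNorm (fun z : Euc d × Euc d => a₁ z.1 (shiftPt (η n) z)) 2 (γ n)
      ≤ supShiftedL2 N η γ a₁ :=
  le_iSup₂ (f := fun k (_ : k < N) =>
    eLpNorm (fun z : Euc d × Euc d => a₁ z.1 (shiftPt (η k) z)) 2 (γ k)) n hn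

lemma eLpNorm_le_supL2 {K : Kernel (Euc d) (Euc d)} {m : Measure (Euc d)} {f : Euc d → ℝ}
    {n : ℕ} (hn : n < N) : eLpNorm f 2 (iterLaw m K n) ≤ supL2 K m N f :=
  le_iSup₂ (f := fun k (_ : k < N) => eLpNorm f 2 (iterLaw m K k)) n hn

/-- The recursion for the root mean square distances along a shifted process. -/
lemma rmsDist_succ_sq_le (h : IsShiftedProcess Phat P μ ν N η γ) {n : ℕ} (hn : n + 1 < N)
    (hη : η n ∈ Set.Icc (0 : ℝ) 1) {L : ℝ} {a₀ : Euc d → ℝ} {a₁ : Euc d → Euc d → ℝ}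
    (ha₀ : Measurable a₀) (ha₁ : Measurable (Function.uncurry a₁)) (ha₁0 : ∀ x y, 0 ≤ a₁ x y)
    (hW : ∀ x y, W2 (Phat x) (P y) ^ 2 ≤
      ENNReal.ofReal (L ^ 2 * ‖x - y‖ ^ 2 + 2 * a₁ x y * ‖x - y‖ + a₀ x ^ 2)) :
    rmsDist (γ (n + 1)) ^ 2 ≤ ENNReal.ofReal (L ^ 2 * (1 - η n) ^ 2) * rmsDist (γ n) ^ 2
      + ENNReal.ofReal (2 * (1 - η n)) * (supShiftedL2 N η γ a₁ * rmsDist (γ n))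
      + supL2 Phat μ N a₀ ^ 2 := by
  have hη1 : 0 ≤ 1 - η n := by linarith [hη.2]
  have hsm := measurable_shiftPt (d := d) (η n)
  have ha₁m : Measurable fun z : Euc d × Euc d => a₁ z.1 (shiftPt (η n) z) :=
    ha₁.comp (measurable_fst.prodMk hsm)
  have hf : Measurable (Function.uncurry fun x y : Euc d =>
      L ^ 2 * ‖x - y‖ ^ 2 + 2 * a₁ x y * ‖x - y‖ + a₀ x ^ 2) := by
    have h1 : Measurable fun z : Euc d × Euc d => ‖z.1 - z.2‖ := by fun_prop
    have h2 : Measurable fun z : Euc d × Euc d => a₁ z.1 z.2 := ha₁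
    have h3 : Measurable fun z : Euc d × Euc d => a₀ z.1 := ha₀.comp measurable_fst
    exact (((h1.pow_const 2).const_mul _).add ((h2.const_mul 2).mul h1)).add (h3.pow_const 2)
  have hstep := quadCost_step_le h hn hf (fun x y => by have := ha₁0 x y; positivity) hW
  rw [rmsDist_sq, rmsDist_sq]
  refine hstep.trans ?_
  -- The transport hypothesis is used at (x̂, ỹ), where x̂ - ỹ = (1 - η)(x̂ - y'); this is the
  -- contraction gained by the shift.
  have hpt : ∀ z : Euc d × Euc d, ENNReal.ofReal (L ^ 2 * ‖z.1 - shiftPt (η n) z‖ ^ 2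
        + 2 * a₁ z.1 (shiftPt (η n) z) * ‖z.1 - shiftPt (η n) z‖ + a₀ z.1 ^ 2)
      = ENNReal.ofReal (L ^ 2 * (1 - η n) ^ 2) * ‖z.1 - z.2‖ₑ ^ 2
        + ENNReal.ofReal (2 * (1 - η n)) * (‖a₁ z.1 (shiftPt (η n) z)‖ₑ * ‖z.1 - z.2‖ₑ)
        + ‖a₀ z.1‖ₑ ^ 2 := fun z => by
    have h1 := ha₁0 z.1 (shiftPt (η n) z)
    rw [fst_sub_shiftPt, norm_smul, Real.norm_of_nonneg hη1,
      ENNReal.ofReal_add (by positivity) (by positivity),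
      ENNReal.ofReal_add (by positivity) (by positivity)]
    congr 1
    · congr 1
      · rw [← ofReal_norm, ← ENNReal.ofReal_pow (norm_nonneg _),
          ← ENNReal.ofReal_mul (by positivity)]
        congr 1; ring
      · rw [← ofReal_norm, ← ofReal_norm, ← ENNReal.ofReal_mul (by positivity),
          ← ENNReal.ofReal_mul (by positivity), Real.norm_of_nonneg h1]
        congr 1; ring
    · rw [← ofReal_norm, ← ENNReal.ofReal_pow (norm_nonneg _), Real.norm_eq_abs, sq_abs]
  simp only [hpt]
  rw [lintegral_add_right _ (by fun_prop), lintegral_add_left (by fun_prop),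
    lintegral_const_mul _ (by fun_prop), lintegral_const_mul _ (by fun_prop)]
  refine add_le_add (add_le_add le_rfl ?_) ?_
  · gcongr
    exact (lintegral_enorm_mul_le (γ n) ha₁m.aestronglyMeasurable
      (measurable_fst.sub measurable_snd).aestronglyMeasurable).trans
      (mul_le_mul' (eLpNorm_le_supShiftedL2 (by omega)) le_rfl)
  · have hmap : ∫⁻ z, ‖a₀ z.1‖ₑ ^ 2 ∂(γ n) = eLpNorm a₀ 2 (iterLaw μ Phat n) ^ 2 := by
      rw [eLpNorm_two_sq, ← map_fst_eq_iterLaw h n (by omega),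
        lintegral_map (by fun_prop) measurable_fst]
    rw [hmap]
    gcongr
    exact eLpNorm_le_supL2 (by omega)

/-! ### Accumulation of the divergence along the process -/

variable [IsProbabilityMeasure ν]

/-- The divergence of the auxiliary process from the chain `ν Pⁿ`. -/
lemma klDiv_map_snd_le (h : IsShiftedProcess Phat P μ ν N η γ) {c : ℝ}
    (hc : ∀ x y, klDiv (P x) (P y) ≤ ENNReal.ofReal (c * ‖x - y‖ ^ 2)) :
    ∀ n, n < N → klDiv ((γ n).map Prod.snd) (iterLaw ν P n) ≤
      ∑ k ∈ Finset.range n, ENNReal.ofReal (c * η k ^ 2) * quadCost (γ k)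
  | 0, _ => by rw [h.init.1.2]; simp [iterLaw, klDiv_self]
  | n + 1, hn => by
    have hp := isProbabilityMeasure_shifted h (show n < N by omega)
    rw [map_snd_succ h hn, Finset.sum_range_succ]
    change klDiv _ ((iterLaw ν P n).bind P) ≤ _
    refine (klDiv_bind_le_of_pair (γ n) (iterLaw ν P n) (shiftKernel P (η n)) P
      (g := fun z => c * ‖shiftPt (η n) z - z.2‖ ^ 2) fun z => hc _ _).trans ?_
    refine add_le_add (klDiv_map_snd_le h hc n (by omega)) (le_of_eq ?_)
    rw [quadCost, ← lintegral_const_mul _ measurable_enorm_sub_sq]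
    refine lintegral_congr fun z => ?_
    rw [shiftPt_sub_snd, norm_smul, mul_pow, Real.norm_eq_abs, sq_abs, ← mul_assoc,
      ENNReal.ofReal_mul' (sq_nonneg _), ENNReal.ofReal_pow (norm_nonneg _), ofReal_norm]

/-- The divergence is bounded by the transport costs along a shifted process. -/
lemma klDiv_iterLaw_le {M : ℕ} (h : IsShiftedProcess Phat P μ ν (M + 1) η γ) {c c' : ℝ}
    (hc'0 : 0 ≤ c') {b : Euc d → ℝ} (hb : Measurable b)
    (hc : ∀ x y, klDiv (P x) (P y) ≤ ENNReal.ofReal (c * ‖x - y‖ ^ 2))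
    (hc' : ∀ x y, klDiv (Phat x) (P y) ≤ ENNReal.ofReal (c' * ‖x - y‖ ^ 2 + b x ^ 2)) :
    klDiv (iterLaw μ Phat (M + 1)) (iterLaw ν P (M + 1)) ≤
      ∑ k ∈ Finset.range M, ENNReal.ofReal (c * η k ^ 2) * quadCost (γ k)
        + (ENNReal.ofReal c' * quadCost (γ M) + supL2 Phat μ (M + 1) b ^ 2) := by
  have hp := isProbabilityMeasure_shifted h (show M < M + 1 by omega)
  have hfst := map_fst_eq_iterLaw h M (by omega)
  have hbind : iterLaw μ Phat (M + 1) = (γ M).bind (firstKernel Phat) := by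
    rw [firstKernel, ← map_bind_eq_bind_comap, hfst]; rfl
  rw [hbind]
  change klDiv _ ((iterLaw ν P M).bind P) ≤ _
  -- The last step leaves from x̂ by `Phat`, so the law reached is that of the original chain; the
  -- cross hypothesis compares it with `P` started at y'.
  refine (klDiv_bind_le_of_pair (γ M) (iterLaw ν P M) (firstKernel Phat) P
    (g := fun z => c' * ‖z.1 - z.2‖ ^ 2 + b z.1 ^ 2) fun z => hc' _ _).trans ?_
  refine add_le_add (klDiv_map_snd_le h hc M (by omega)) ?_
  have hpt : ∀ z : Euc d × Euc d, ENNReal.ofReal (c' * ‖z.1 - z.2‖ ^ 2 + b z.1 ^ 2)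
      = ENNReal.ofReal c' * ‖z.1 - z.2‖ₑ ^ 2 + ‖b z.1‖ₑ ^ 2 := fun z => by
    rw [ENNReal.ofReal_add (by positivity) (by positivity), ENNReal.ofReal_mul hc'0,
      ENNReal.ofReal_pow (norm_nonneg _), ofReal_norm, ← ofReal_norm (b z.1),
      ← ENNReal.ofReal_pow (norm_nonneg _), Real.norm_eq_abs, sq_abs]
  simp only [hpt]
  rw [lintegral_add_right _ (by fun_prop), lintegral_const_mul _ (by fun_prop)]
  refine add_le_add le_rfl ?_
  have hmap : ∫⁻ z, ‖b z.1‖ₑ ^ 2 ∂(γ M) = eLpNorm b 2 (iterLaw μ Phat M) ^ 2 := by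
    rw [eLpNorm_two_sq, ← hfst, lintegral_map (by fun_prop) measurable_fst]
  rw [hmap]
  gcongr
  exact eLpNorm_le_supL2 (by omega)

end ShiftedLaws

/-! ### The shifts and the deterministic recursion -/

/-- The geometric sum `1 + r + ⋯ + rᵐ⁻¹`. -/
noncomputable def geomSum (r : ℝ) (m : ℕ) : ℝ := ∑ j ∈ Finset.range m, r ^ j

lemma geomSum_zero (r : ℝ) : geomSum r 0 = 0 := by simp [geomSum]

/-- This form of the recursion yields 1 - 1 / Sₘ₊₁ = r Sₘ / Sₘ₊₁, the identity behind the choice of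
shifts. -/
lemma geomSum_succ (r : ℝ) (m : ℕ) : geomSum r (m + 1) = 1 + r * geomSum r m := by
  simp only [geomSum, Finset.sum_range_succ', Finset.mul_sum, pow_succ, pow_zero]
  rw [add_comm]
  congr 1
  exact Finset.sum_congr rfl fun i _ => mul_comm _ _

lemma geomSum_one (m : ℕ) : geomSum 1 m = m := by simp [geomSum]

lemma geomSum_nonneg {r : ℝ} (hr : 0 ≤ r) (m : ℕ) : 0 ≤ geomSum r m :=
  Finset.sum_nonneg fun _ _ => pow_nonneg hr _

lemma one_le_geomSum_succ {r : ℝ} (hr : 0 ≤ r) (m : ℕ) : 1 ≤ geomSum r (m + 1) := by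
  rw [geomSum_succ]
  nlinarith [mul_nonneg hr (geomSum_nonneg hr m)]

lemma one_le_geomSum {r : ℝ} (hr : 0 ≤ r) {m : ℕ} (hm : 1 ≤ m) : 1 ≤ geomSum r m := by
  obtain ⟨k, rfl⟩ := Nat.exists_eq_add_of_le' hm
  exact one_le_geomSum_succ hr k

lemma le_geomSum {r : ℝ} (hr : 1 ≤ r) (m : ℕ) : (m : ℝ) ≤ geomSum r m := by
  have := Finset.card_nsmul_le_sum (Finset.range m) (fun j => r ^ j) 1
    fun j _ => one_le_pow₀ hr
  simpa [geomSum] using this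

/-- The arithmetic-geometric mean inequality for geometric sums. -/
lemma sq_mul_pow_le_geomSum_sq {r : ℝ} (hr : 0 ≤ r) (m : ℕ) :
    (m : ℝ) ^ 2 * r ^ (m - 1) ≤ geomSum r m ^ 2 := by
  set s := √r with hs
  have hsr : s ^ 2 = r := Real.sq_sqrt hr
  -- Cauchy–Schwarz pairs each power of √r with its reflection, so that every product equals √r ^ (m
  -- - 1).
  have h := Finset.sum_mul_sq_le_sq_mul_sq (Finset.range m) (fun j => s ^ j)
    fun j => s ^ (m - 1 - j)
  have h1 : ∑ j ∈ Finset.range m, s ^ j * s ^ (m - 1 - j) = m * s ^ (m - 1) := by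
    rw [Finset.sum_congr rfl fun j hj => ?_, Finset.sum_const, Finset.card_range, nsmul_eq_mul]
    rw [← pow_add]
    congr 1
    have := Finset.mem_range.1 hj
    omega
  have h2 : ∑ j ∈ Finset.range m, (s ^ j) ^ 2 = geomSum r m :=
    Finset.sum_congr rfl fun j _ => by rw [← hsr, pow_right_comm]
  have h3 : ∑ j ∈ Finset.range m, (s ^ (m - 1 - j)) ^ 2 = geomSum r m := by
    rw [Finset.sum_range_reflect (fun j => (s ^ j) ^ 2) m, h2]
  rw [h1, h2, h3] at h
  calc (m : ℝ) ^ 2 * r ^ (m - 1) = (m * s ^ (m - 1)) ^ 2 := by rw [← hsr]; ring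
    _ ≤ geomSum r m * geomSum r m := h
    _ = geomSum r m ^ 2 := (sq _).symm

/-- Summation of a linear recursion. -/
lemma sum_le_of_linear_recursion {q : ℝ} (hq : 0 ≤ q) (M : ℕ) {x y : ℕ → ℝ}
    (h : ∀ n < M, x (n + 1) ≤ q * x n + y n) :
    ∑ n ∈ Finset.range (M + 1), x n ≤
      geomSum q (M + 1) * x 0 + ∑ k ∈ Finset.range M, geomSum q (M - k) * y k := by
  induction M generalizing x y with
  | zero => simp [geomSum]
  | succ M ih =>
    -- The induction removes index 0: the tail is bounded through `x 1`, which is then replaced by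
    -- `q * x 0 + y 0`.
    have h' := ih (x := fun n => x (n + 1)) (y := fun n => y (n + 1))
      fun n hn => h (n + 1) (by omega)
    have h0 := mul_le_mul_of_nonneg_left (h 0 (by omega)) (geomSum_nonneg hq (M + 1))
    rw [Finset.sum_range_succ' x, Finset.sum_range_succ' (fun k => geomSum q (M + 1 - k) * y k) M,
      geomSum_succ q (M + 1)]
    simp only [Nat.add_sub_add_right, Nat.sub_zero, zero_add] at h' h0 ⊢
    linarith

/-- The ratio of the geometric weights defining the shifts. -/
noncomputable def shiftRatio (L : ℝ) : ℝ := if L < 1 then L⁻¹ else (L ^ 2)⁻¹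

/-- The shifts `ηₙ = 1 / (1 + r + ⋯ + rᴺ⁻ⁿ⁻¹)`. -/
noncomputable def shiftSeq (L : ℝ) (N n : ℕ) : ℝ := (geomSum (shiftRatio L) (N - n))⁻¹

lemma shiftRatio_pos {L : ℝ} (hL : 0 < L) : 0 < shiftRatio L := by
  unfold shiftRatio
  split_ifs <;> positivity

lemma shiftSeq_mem {L : ℝ} (hL : 0 < L) (N n : ℕ) : shiftSeq L N n ∈ Set.Icc (0 : ℝ) 1 := by
  have hr := (shiftRatio_pos hL).le
  refine ⟨inv_nonneg.2 (geomSum_nonneg hr _), ?_⟩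
  unfold shiftSeq
  rcases Nat.eq_zero_or_pos (N - n) with h | h
  -- For `n ≥ N` the sum is empty and the shift is 0⁻¹ = 0.
  · rw [h, geomSum_zero]; simp
  · exact inv_le_one_of_one_le₀ (one_le_geomSum hr h)

lemma shiftSeq_last (L : ℝ) {N : ℕ} (hN : 1 ≤ N) : shiftSeq L N (N - 1) = 1 := by
  rw [shiftSeq, show N - (N - 1) = 0 + 1 by omega, geomSum_succ, geomSum_zero]
  simp

/-- The energy `∑ ηₙ² dₙ²` of a sequence satisfying the shifted recursion, for general weights. -/
lemma sum_sq_le_of_shifted_recursion {L r q : ℝ} (hr : 0 < r) (hq : q = (L * r) ^ 2) (M : ℕ)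
    {d : ℕ → ℝ} {A₀ A₁ : ℝ}
    (h : ∀ n < M, d (n + 1) ^ 2 ≤ L ^ 2 * (1 - (geomSum r (M + 1 - n))⁻¹) ^ 2 * d n ^ 2
      + 2 * (1 - (geomSum r (M + 1 - n))⁻¹) * (A₁ * d n) + A₀ ^ 2) :
    ∑ n ∈ Finset.range (M + 1), (geomSum r (M + 1 - n))⁻¹ ^ 2 * d n ^ 2 ≤
      2 * (geomSum q (M + 1) / geomSum r (M + 1) ^ 2) * d 0 ^ 2
        + 4 * r ^ 2 * A₁ ^ 2 * ∑ m ∈ Finset.range M, (geomSum q (m + 1) / geomSum r (m + 1)) ^ 2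
        + 2 * A₀ ^ 2 * ∑ m ∈ Finset.range M, geomSum q (m + 1) / geomSum r (m + 1) ^ 2 := by
  have hq0 : 0 ≤ q := hq ▸ sq_nonneg _
  set e : ℕ → ℝ := fun n => d n / geomSum r (M + 1 - n) with he
  have hrec : ∀ n < M, e (n + 1) ^ 2 ≤ q * e n ^ 2
      + (2 * A₁ * r * e n / geomSum r (M - n) + A₀ ^ 2 / geomSum r (M - n) ^ 2) := by
    intro n hn
    have h0 := h n hn
    have h1 : M + 1 - n = (M - n) + 1 := by omega
    have hS := one_le_geomSum hr.le (show 1 ≤ M - n by omega)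
    have hS' := one_le_geomSum_succ hr.le (M - n)
    simp only [he, Nat.add_sub_add_right]
    rw [h1] at h0 ⊢
    set S := geomSum r (M - n) with hSdef
    set S' := geomSum r (M - n + 1) with hSdef'
    have hSS : S' = 1 + r * S := geomSum_succ r _
    have hη : 1 - S'⁻¹ = r * S / S' := by
      field_simp
      linarith
    rw [hη] at h0
    rw [div_pow, div_le_iff₀ (by positivity)]
    refine h0.trans (le_of_eq ?_)
    rw [hq]
    field_simp
    ring
  have hsum := sum_le_of_linear_recursion hq0 M (x := fun n => e n ^ 2) hrec
  have hT : ∑ n ∈ Finset.range (M + 1), (geomSum r (M + 1 - n))⁻¹ ^ 2 * d n ^ 2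
      = ∑ n ∈ Finset.range (M + 1), e n ^ 2 :=
    Finset.sum_congr rfl fun n _ => by simp only [he]; ring
  -- Young's inequality with weight 1/2 on `e k ^ 2`: half of the energy is absorbed on the left,
  -- which doubles the other terms.
  have hterm : ∀ k ∈ Finset.range M,
      geomSum q (M - k) * (2 * A₁ * r * e k / geomSum r (M - k)
        + A₀ ^ 2 / geomSum r (M - k) ^ 2) ≤
      1 / 2 * e k ^ 2 + 2 * r ^ 2 * A₁ ^ 2 * (geomSum q (M - k) / geomSum r (M - k)) ^ 2
        + A₀ ^ 2 * (geomSum q (M - k) / geomSum r (M - k) ^ 2) := by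
    intro k _
    have h1 := sq_nonneg (e k - 2 * A₁ * r * (geomSum q (M - k) / geomSum r (M - k)))
    have h2 : geomSum q (M - k) * (2 * A₁ * r * e k / geomSum r (M - k)
        + A₀ ^ 2 / geomSum r (M - k) ^ 2)
        = 2 * A₁ * r * (geomSum q (M - k) / geomSum r (M - k)) * e k
          + A₀ ^ 2 * (geomSum q (M - k) / geomSum r (M - k) ^ 2) := by ring
    rw [h2]
    nlinarith
  have hsum2 := Finset.sum_le_sum hterm
  have hrefl : ∀ g : ℕ → ℝ, ∑ k ∈ Finset.range M, g (M - k) = ∑ m ∈ Finset.range M, g (m + 1) := by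
    intro g
    rw [← Finset.sum_range_reflect (fun m => g (m + 1)) M]
    refine Finset.sum_congr rfl fun k hk => ?_
    have := Finset.mem_range.1 hk
    congr 1
    omega
  rw [Finset.sum_add_distrib, Finset.sum_add_distrib, ← Finset.mul_sum, ← Finset.mul_sum,
    ← Finset.mul_sum, hrefl fun m => (geomSum q m / geomSum r m) ^ 2,
    hrefl fun m => geomSum q m / geomSum r m ^ 2] at hsum2
  have hle : ∑ k ∈ Finset.range M, e k ^ 2 ≤ ∑ k ∈ Finset.range (M + 1), e k ^ 2 := by
    rw [Finset.sum_range_succ]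
    exact le_add_of_nonneg_right (sq_nonneg _)
  have he0 : geomSum q (M + 1) * e 0 ^ 2
      = geomSum q (M + 1) / geomSum r (M + 1) ^ 2 * d 0 ^ 2 := by
    simp only [he, Nat.sub_zero]; ring
  rw [hT]
  rw [he0] at hsum
  linarith

/-! ### Bounds for the coefficients -/

lemma wCoeff_eq (L : ℝ) (N : ℕ) : wCoeff L N = (geomSum L⁻¹ N)⁻¹ := by
  unfold wCoeff
  split_ifs with h
  · rw [h, inv_one, geomSum_one, one_div]
  · rw [geomSum, geom_sum_eq (by simpa using h), inv_div, inv_pow]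

lemma wCoeff_pos {L : ℝ} (hL : 0 < L) {N : ℕ} (hN : 1 ≤ N) : 0 < wCoeff L N := by
  rw [wCoeff_eq L]
  exact inv_pos.2 (zero_lt_one.trans_le (one_le_geomSum (by positivity) hN))

lemma two_le_inv_one_sub {L : ℝ} (hL : 1 / 2 ≤ L) (h1 : L < 1) : 2 ≤ 1 / (1 - L) := by
  rw [le_div_iff₀ (by linarith)]
  linarith

/-- Since L ≥ 1/2, N̄ is at least 2 as soon as N ≥ 2. Hence log N̄ > 0, which matters when ā₀ is
infinite. -/
lemma min_le_barN {L : ℝ} (hL : 1 / 2 ≤ L) (N : ℕ) : min (N : ℝ) 2 ≤ barN L N := by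
  unfold barN
  split_ifs with h
  · exact min_le_min_left _ (two_le_inv_one_sub hL h)
  · exact min_le_left _ _

lemma one_le_barN {L : ℝ} (hL : 1 / 2 ≤ L) {N : ℕ} (hN : 1 ≤ N) : 1 ≤ barN L N :=
  (le_min (by exact_mod_cast hN) one_le_two).trans (min_le_barN hL N)

lemma log_barN_pos {L : ℝ} (hL : 1 / 2 ≤ L) {N : ℕ} (hN : 2 ≤ N) : 0 < Real.log (barN L N) := by
  refine Real.log_pos (lt_of_lt_of_le one_lt_two ?_)
  exact (le_min (by exact_mod_cast hN) le_rfl).trans (min_le_barN hL N)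

lemma sum_inv_le_log (M : ℕ) :
    ∑ m ∈ Finset.range M, ((m : ℝ) + 1)⁻¹ ≤ 3 * Real.log ((M + 1 : ℕ) : ℝ) := by
  rcases Nat.eq_zero_or_pos M with rfl | hM
  · simp
  have h := harmonic_le_one_add_log M
  have h1 : ((harmonic M : ℚ) : ℝ) = ∑ m ∈ Finset.range M, ((m : ℝ) + 1)⁻¹ := by
    simp [harmonic]
  rw [h1] at h
  have hM' : (1 : ℝ) ≤ M := by exact_mod_cast hM
  have h2 : Real.log M ≤ Real.log ((M + 1 : ℕ) : ℝ) :=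
    Real.log_le_log (by positivity) (by push_cast; linarith)
  have h3 : Real.log 2 ≤ Real.log ((M + 1 : ℕ) : ℝ) :=
    Real.log_le_log (by norm_num) (by push_cast; linarith)
  -- The 1 in the harmonic bound is at most 2 log 2, hence the factor 3.
  linarith [Real.log_two_gt_d9]

/-- Write 1 = S (1 - p) + pᵐ⁺¹ and bound the last power by the smallest term of S, which is at most
the average S / (m + 1). -/
lemma inv_geomSum_le {p : ℝ} (hp : 0 ≤ p) (hp1 : p ≤ 1) (m : ℕ) :
    (geomSum p (m + 1))⁻¹ ≤ ((m : ℝ) + 1)⁻¹ + (1 - p) := by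
  have hS := one_le_geomSum_succ hp m
  have hgeom : geomSum p (m + 1) * (1 - p) = 1 - p ^ (m + 1) := geom_sum_mul_neg p (m + 1)
  have hlow : ((m : ℝ) + 1) * p ^ m ≤ geomSum p (m + 1) := by
    have := Finset.card_nsmul_le_sum (Finset.range (m + 1)) (fun j => p ^ j) (p ^ m)
      fun j hj => pow_le_pow_of_le_one hp hp1 (by have := Finset.mem_range.1 hj; omega)
    simpa [geomSum] using this
  rw [inv_le_iff_one_le_mul₀ (by positivity)]
  have h1 : p ^ m ≤ ((m : ℝ) + 1)⁻¹ * geomSum p (m + 1) := by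
    rw [inv_mul_eq_div, le_div_iff₀ (by positivity)]
    linarith
  have h2 : p ^ (m + 1) ≤ p ^ m := pow_le_pow_of_le_one hp hp1 (Nat.le_succ m)
  nlinarith

/-- Pairing consecutive powers in a sum of length 2m gives the factor 1 + p ≤ 2. For L ≥ 1 this
relates the ratio L⁻² of the shifts to the ratio L⁻¹ in `wCoeff`. -/
lemma geomSum_le_two_mul_geomSum_sq {p : ℝ} (hp : 0 ≤ p) (hp1 : p ≤ 1) (m : ℕ) :
    geomSum p m ≤ 2 * geomSum (p ^ 2) m := by
  have h1 : geomSum p m ≤ geomSum p (2 * m) :=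
    Finset.sum_le_sum_of_subset_of_nonneg (Finset.range_mono (by omega))
      fun _ _ _ => pow_nonneg hp _
  have h2 : ∀ m, geomSum p (2 * m) = (1 + p) * geomSum (p ^ 2) m := by
    intro m
    induction m with
    | zero => simp [geomSum]
    | succ m ih =>
      rw [show 2 * (m + 1) = 2 * m + 1 + 1 by ring, geomSum_succ, geomSum_succ, ih, geomSum_succ]
      ring
  rw [h2] at h1
  nlinarith [geomSum_nonneg (sq_nonneg p) m]

/-- Energy bound in the expansive case. -/
lemma energy_le_of_one_le {L : ℝ} (hL : 1 ≤ L) (M : ℕ) {d : ℕ → ℝ} {A₀ A₁ : ℝ}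
    (h : ∀ n < M, d (n + 1) ^ 2 ≤ L ^ 2 * (1 - shiftSeq L (M + 1) n) ^ 2 * d n ^ 2
      + 2 * (1 - shiftSeq L (M + 1) n) * (A₁ * d n) + A₀ ^ 2) :
    ∑ n ∈ Finset.range (M + 1), shiftSeq L (M + 1) n ^ 2 * d n ^ 2 ≤
      16 * (wCoeff L (M + 1) * d 0 ^ 2
        + max ((L - 1) * (M + 1 : ℕ)) (Real.log (barN L (M + 1))) * A₀ ^ 2
        + barN L (M + 1) * A₁ ^ 2) := by
  have hL0 : 0 < L := by linarith
  have hnot : ¬ L < 1 := not_lt.2 hL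
  simp only [shiftSeq, shiftRatio, if_neg hnot] at h ⊢
  set p := L⁻¹ with hp
  have hp0 : 0 < p := by positivity
  have hp1 : p ≤ 1 := inv_le_one_of_one_le₀ hL
  have hpL : L * p = 1 := mul_inv_cancel₀ hL0.ne'
  have hr : (L ^ 2)⁻¹ = p ^ 2 := by rw [hp, inv_pow]
  rw [hr] at h ⊢
  -- Here q = r, so each quotient of geometric sums weighting A₁ is 1 and those weighting A₀ are 1 /
  -- Sₘ.
  have hq : p ^ 2 = (L * p ^ 2) ^ 2 := by
    calc p ^ 2 = (L * p) ^ 2 * p ^ 2 := by rw [hpL]; ring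
      _ = _ := by ring
  refine (sum_sq_le_of_shifted_recursion (by positivity) hq M h).trans ?_
  have hp2 : p ^ 2 ≤ 1 := pow_le_one₀ hp0.le hp1
  have hpos : ∀ m, 0 < geomSum (p ^ 2) (m + 1) := fun m =>
    zero_lt_one.trans_le (one_le_geomSum_succ (sq_nonneg p) m)
  have hdiv : ∀ m, geomSum (p ^ 2) (m + 1) / geomSum (p ^ 2) (m + 1) ^ 2
      = (geomSum (p ^ 2) (m + 1))⁻¹ := fun m => by
    have := (hpos m).ne'
    field_simp
  have hw : geomSum (p ^ 2) (M + 1) / geomSum (p ^ 2) (M + 1) ^ 2 ≤ 2 * wCoeff L (M + 1) := by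
    rw [hdiv, wCoeff_eq L, ← hp, ← div_eq_mul_inv,
      le_div_iff₀ (zero_lt_one.trans_le (one_le_geomSum_succ hp0.le M)),
      inv_mul_le_iff₀ (hpos M)]
    linarith [geomSum_le_two_mul_geomSum_sq hp0.le hp1 (M + 1)]
  have hb : barN L (M + 1) = (M + 1 : ℕ) := by rw [barN, if_neg hnot]
  have h1 : (p ^ 2) ^ 2 * ∑ m ∈ Finset.range M,
      (geomSum (p ^ 2) (m + 1) / geomSum (p ^ 2) (m + 1)) ^ 2 ≤ barN L (M + 1) := by
    rw [Finset.sum_congr rfl fun m _ => by rw [div_self (hpos m).ne', one_pow], hb]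
    simp only [Finset.sum_const, Finset.card_range, nsmul_eq_mul, mul_one]
    push_cast
    have : (p ^ 2) ^ 2 ≤ 1 := pow_le_one₀ (sq_nonneg p) hp2
    nlinarith [Nat.cast_nonneg (α := ℝ) M]
  have h0 : ∑ m ∈ Finset.range M, geomSum (p ^ 2) (m + 1) / geomSum (p ^ 2) (m + 1) ^ 2
      ≤ 5 * max ((L - 1) * (M + 1 : ℕ)) (Real.log (barN L (M + 1))) := by
    calc ∑ m ∈ Finset.range M, geomSum (p ^ 2) (m + 1) / geomSum (p ^ 2) (m + 1) ^ 2
        ≤ ∑ m ∈ Finset.range M, (((m : ℝ) + 1)⁻¹ + (1 - p ^ 2)) :=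
          Finset.sum_le_sum fun m _ => (hdiv m).le.trans (inv_geomSum_le (sq_nonneg p) hp2 m)
      _ = ∑ m ∈ Finset.range M, ((m : ℝ) + 1)⁻¹ + M * (1 - p ^ 2) := by
          rw [Finset.sum_add_distrib, Finset.sum_const, Finset.card_range, nsmul_eq_mul]
      _ ≤ 3 * Real.log (barN L (M + 1)) + 2 * ((L - 1) * (M + 1 : ℕ)) := by
          rw [hb]
          refine add_le_add (sum_inv_le_log M) ?_
          have h2 : 1 - p ^ 2 ≤ 2 * (L - 1) := by nlinarith
          have h3 : 0 ≤ L - 1 := by linarith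
          push_cast
          nlinarith [mul_le_mul_of_nonneg_left h2 (Nat.cast_nonneg (α := ℝ) M)]
      _ ≤ _ := by
          linarith [le_max_left ((L - 1) * (M + 1 : ℕ)) (Real.log (barN L (M + 1))),
            le_max_right ((L - 1) * (M + 1 : ℕ)) (Real.log (barN L (M + 1)))]
  have e1 := mul_le_mul_of_nonneg_right hw (sq_nonneg (d 0))
  have e2 := mul_le_mul_of_nonneg_right h1 (sq_nonneg A₁)
  have e3 := mul_le_mul_of_nonneg_right h0 (sq_nonneg A₀)
  have n1 : 0 ≤ wCoeff L (M + 1) * d 0 ^ 2 :=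
    mul_nonneg (wCoeff_pos hL0 (by omega)).le (sq_nonneg _)
  have n2 : 0 ≤ barN L (M + 1) * A₁ ^ 2 := by rw [hb]; positivity
  have n3 : 0 ≤ max ((L - 1) * (M + 1 : ℕ)) (Real.log (barN L (M + 1))) * A₀ ^ 2 :=
    mul_nonneg (le_max_of_le_left (mul_nonneg (by linarith) (Nat.cast_nonneg _))) (sq_nonneg _)
  nlinarith

/-- Energy bound in the contractive case. -/
lemma energy_le_of_lt_one {L : ℝ} (hL : 1 / 2 ≤ L) (hL1 : L < 1) (M : ℕ) {d : ℕ → ℝ} {A₀ A₁ : ℝ}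
    (h : ∀ n < M, d (n + 1) ^ 2 ≤ L ^ 2 * (1 - shiftSeq L (M + 1) n) ^ 2 * d n ^ 2
      + 2 * (1 - shiftSeq L (M + 1) n) * (A₁ * d n) + A₀ ^ 2) :
    ∑ n ∈ Finset.range (M + 1), shiftSeq L (M + 1) n ^ 2 * d n ^ 2 ≤
      16 * (wCoeff L (M + 1) * d 0 ^ 2
        + max ((L - 1) * (M + 1 : ℕ)) (Real.log (barN L (M + 1))) * A₀ ^ 2
        + barN L (M + 1) * A₁ ^ 2) := by
  have hL0 : 0 < L := by linarith
  simp only [shiftSeq, shiftRatio, if_pos hL1] at h ⊢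
  set r := L⁻¹ with hr
  have hr0 : 0 < r := by positivity
  have hr1 : 1 ≤ r := (one_le_inv₀ hL0).2 hL1.le
  have hr2 : r ≤ 2 := by
    rw [hr, inv_le_comm₀ hL0 two_pos]; linarith
  have hrL : L * r = 1 := mul_inv_cancel₀ hL0.ne'
  have hq : (1 : ℝ) = (L * r) ^ 2 := by rw [hrL, one_pow]
  refine (sum_sq_le_of_shifted_recursion hr0 hq M h).trans ?_
  simp only [geomSum_one]
  have hpos : ∀ m, 0 < geomSum r (m + 1) := fun m =>
    zero_lt_one.trans_le (one_le_geomSum_succ hr0.le m)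
  have hw : ((M + 1 : ℕ) : ℝ) / geomSum r (M + 1) ^ 2 ≤ wCoeff L (M + 1) := by
    rw [wCoeff_eq L, ← hr, div_le_iff₀ (pow_pos (hpos M) 2)]
    refine (le_geomSum hr1 (M + 1)).trans (le_of_eq ?_)
    have := (hpos M).ne'
    field_simp
  -- Here q = 1, so the numerators are plain lengths; this geometric decay bounds the A₁ sum by N̄
  -- and turns the A₀ sum into a truncated logarithmic series.
  have hρ : ∀ m : ℕ, (((m + 1 : ℕ) : ℝ) / geomSum r (m + 1)) ^ 2 ≤ L ^ m := fun m => by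
    rw [div_pow, div_le_iff₀ (pow_pos (hpos m) 2)]
    have h1 := sq_mul_pow_le_geomSum_sq hr0.le (m + 1)
    have h2 := mul_le_mul_of_nonneg_left h1 (pow_nonneg hL0.le m)
    calc ((m + 1 : ℕ) : ℝ) ^ 2 = L ^ m * (((m + 1 : ℕ) : ℝ) ^ 2 * r ^ m) := by
          rw [mul_left_comm, ← mul_pow, hrL, one_pow, mul_one]
      _ ≤ _ := h2
  have hb : barN L (M + 1) = min ((M + 1 : ℕ) : ℝ) (1 / (1 - L)) := by rw [barN, if_pos hL1]
  have h1L : 0 < 1 - L := by linarith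
  have hgeom : ∑ m ∈ Finset.range M, L ^ m ≤ barN L (M + 1) := by
    rw [hb]
    refine le_min ?_ ?_
    · calc ∑ m ∈ Finset.range M, L ^ m ≤ ∑ m ∈ Finset.range M, (1 : ℝ) :=
            Finset.sum_le_sum fun m _ => pow_le_one₀ hL0.le hL1.le
        _ ≤ _ := by simp
    · have := geom_sum_mul_neg L M
      rw [le_div_iff₀ h1L, this]
      linarith [pow_pos hL0 M]
  have h1 : r ^ 2 * ∑ m ∈ Finset.range M, (((m + 1 : ℕ) : ℝ) / geomSum r (m + 1)) ^ 2
      ≤ 4 * barN L (M + 1) := by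
    have hle := (Finset.sum_le_sum fun m (_ : m ∈ Finset.range M) => hρ m).trans hgeom
    have hr4 : r ^ 2 ≤ 4 := by nlinarith
    exact mul_le_mul hr4 hle (Finset.sum_nonneg fun m _ => sq_nonneg _) (by norm_num)
  have h0 : ∑ m ∈ Finset.range M, ((m + 1 : ℕ) : ℝ) / geomSum r (m + 1) ^ 2
      ≤ 3 * max ((L - 1) * (M + 1 : ℕ)) (Real.log (barN L (M + 1))) := by
    have hstep : ∑ m ∈ Finset.range M, ((m + 1 : ℕ) : ℝ) / geomSum r (m + 1) ^ 2
        ≤ ∑ m ∈ Finset.range M, L ^ m / ((m : ℝ) + 1) := by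
      refine Finset.sum_le_sum fun m _ => ?_
      rw [le_div_iff₀ (by positivity)]
      refine le_trans (le_of_eq ?_) (hρ m)
      push_cast
      ring
    refine hstep.trans (le_trans ?_ (mul_le_mul_of_nonneg_left (le_max_right _ _) (by norm_num)))
    -- If N̄ = N, the powers of L are dropped and the harmonic sum remains. Otherwise log N̄ = -log
    -- (1 - L), whose power series dominates the sum up to the factor r ≤ 2.
    rcases min_choice ((M + 1 : ℕ) : ℝ) (1 / (1 - L)) with hc | hc
    · rw [hb, hc]
      refine le_trans (Finset.sum_le_sum fun m _ => ?_) (sum_inv_le_log M)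
      rw [div_eq_mul_inv]
      exact mul_le_of_le_one_left (by positivity) (pow_le_one₀ hL0.le hL1.le)
    · rw [hb, hc, one_div, Real.log_inv]
      have hs := Real.hasSum_pow_div_log_of_abs_lt_one (x := L) (by rwa [abs_of_pos hL0])
      have hle := sum_le_hasSum (Finset.range M) (fun i _ => by positivity) hs
      have heq : ∑ m ∈ Finset.range M, L ^ m / ((m : ℝ) + 1)
          = r * ∑ m ∈ Finset.range M, L ^ (m + 1) / ((m : ℝ) + 1) := by
        rw [Finset.mul_sum]
        refine Finset.sum_congr rfl fun m _ => ?_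
        rw [pow_succ, mul_div_assoc', mul_left_comm, mul_comm r L, hrL, mul_one]
      rw [heq]
      have hnn : 0 ≤ ∑ m ∈ Finset.range M, L ^ (m + 1) / ((m : ℝ) + 1) :=
        Finset.sum_nonneg fun m _ => by positivity
      nlinarith
  have e1 := mul_le_mul_of_nonneg_right hw (sq_nonneg (d 0))
  have e2 := mul_le_mul_of_nonneg_right h1 (sq_nonneg A₁)
  have e3 := mul_le_mul_of_nonneg_right h0 (sq_nonneg A₀)
  have n1 : 0 ≤ wCoeff L (M + 1) * d 0 ^ 2 :=
    mul_nonneg (wCoeff_pos hL0 (by omega)).le (sq_nonneg _)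
  have n2 : 0 ≤ barN L (M + 1) * A₁ ^ 2 :=
    mul_nonneg (zero_le_one.trans (one_le_barN hL (by omega))) (sq_nonneg _)
  have n3 : 0 ≤ max ((L - 1) * (M + 1 : ℕ)) (Real.log (barN L (M + 1))) * A₀ ^ 2 :=
    mul_nonneg (le_max_of_le_right (Real.log_nonneg (one_le_barN hL (by omega)))) (sq_nonneg _)
  nlinarith

/-! ### The main theorem -/

/-- Energy bound for real sequences, in both regimes of `L`. -/
lemma energy_le {L : ℝ} (hL : 1 / 2 ≤ L) (M : ℕ) {d : ℕ → ℝ} {A₀ A₁ : ℝ}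
    (h : ∀ n < M, d (n + 1) ^ 2 ≤ L ^ 2 * (1 - shiftSeq L (M + 1) n) ^ 2 * d n ^ 2
      + 2 * (1 - shiftSeq L (M + 1) n) * (A₁ * d n) + A₀ ^ 2) :
    ∑ n ∈ Finset.range (M + 1), shiftSeq L (M + 1) n ^ 2 * d n ^ 2 ≤
      16 * (wCoeff L (M + 1) * d 0 ^ 2
        + max ((L - 1) * (M + 1 : ℕ)) (Real.log (barN L (M + 1))) * A₀ ^ 2
        + barN L (M + 1) * A₁ ^ 2) := by
  rcases lt_or_ge L 1 with h1 | h1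
  · exact energy_le_of_lt_one hL h1 M h
  · exact energy_le_of_one_le h1 M h

/-- Energy bound for sequences with values in `[0, ∞]`. -/
lemma ennreal_energy_le {L : ℝ} (hL : 1 / 2 ≤ L) (M : ℕ) {δ : ℕ → ℝ≥0∞} {A₀ A₁ : ℝ≥0∞}
    (h : ∀ n < M, δ (n + 1) ^ 2 ≤
      ENNReal.ofReal (L ^ 2 * (1 - shiftSeq L (M + 1) n) ^ 2) * δ n ^ 2
      + ENNReal.ofReal (2 * (1 - shiftSeq L (M + 1) n)) * (A₁ * δ n) + A₀ ^ 2) :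
    ∑ n ∈ Finset.range (M + 1), ENNReal.ofReal (shiftSeq L (M + 1) n ^ 2) * δ n ^ 2 ≤
      ENNReal.ofReal 16 * (ENNReal.ofReal (wCoeff L (M + 1)) * δ 0 ^ 2
        + ENNReal.ofReal (max ((L - 1) * (M + 1 : ℕ)) (Real.log (barN L (M + 1)))) * A₀ ^ 2
        + ENNReal.ofReal (barN L (M + 1)) * A₁ ^ 2) := by
  have hL0 : 0 < L := by linarith
  have hw := wCoeff_pos hL0 (show 1 ≤ M + 1 by omega)
  have hb : 0 < barN L (M + 1) := zero_lt_one.trans_le (one_le_barN hL (by omega))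
  have hη : ∀ n, 0 ≤ 1 - shiftSeq L (M + 1) n := fun n => by
    linarith [(shiftSeq_mem hL0 (M + 1) n).2]
  rcases Nat.eq_zero_or_pos M with rfl | hM
  -- The case N = 1 is separate: the log term may vanish, and 0 · ∞ = 0 would spoil the argument for
  -- infinite A₀. Only the initial cost is present.
  · have h1 : wCoeff L (0 + 1) = 1 := by simp [wCoeff_eq, geomSum]
    have h2 : shiftSeq L (0 + 1) 0 = 1 := shiftSeq_last L le_rfl
    rw [Finset.sum_range_one, h1, h2, one_pow, ENNReal.ofReal_one, one_mul, add_assoc]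
    calc δ 0 ^ 2 ≤ 1 * (δ 0 ^ 2 + _) := by rw [one_mul]; exact le_self_add
      _ ≤ _ := mul_le_mul' (by simp) le_rfl
  set m := max ((L - 1) * (M + 1 : ℕ)) (Real.log (barN L (M + 1))) with hm
  have hm0 : 0 < m := lt_max_of_lt_right (log_barN_pos hL (by omega))
  -- All three coefficients are now positive, so an infinite datum makes the right side infinite;
  -- otherwise every δ is finite and the real bound applies.
  by_cases hW : δ 0 = ∞
  · simp [hW, hw, ENNReal.mul_top]
  by_cases hA₀ : A₀ = ∞
  · simp [hA₀, hm0, ENNReal.mul_top]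
  by_cases hA₁ : A₁ = ∞
  · simp [hA₁, hb, ENNReal.mul_top]
  have hfin : ∀ n ≤ M, δ n ≠ ∞ := by
    intro n
    induction n with
    | zero => exact fun _ => hW
    | succ n ih =>
      intro hn
      have hn' := ih (by omega)
      have hne := ne_top_of_le_ne_top (b := ENNReal.ofReal
        (L ^ 2 * (1 - shiftSeq L (M + 1) n) ^ 2) * δ n ^ 2
        + ENNReal.ofReal (2 * (1 - shiftSeq L (M + 1) n)) * (A₁ * δ n) + A₀ ^ 2)
        (by finiteness) (h n (by omega))
      intro htop
      simp [htop] at hne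
  have hofReal : ∀ n ≤ M, δ n = ENNReal.ofReal (δ n).toReal := fun n hn =>
    (ENNReal.ofReal_toReal (hfin n hn)).symm
  have hreal : ∀ n < M, (δ (n + 1)).toReal ^ 2 ≤
      L ^ 2 * (1 - shiftSeq L (M + 1) n) ^ 2 * (δ n).toReal ^ 2
      + 2 * (1 - shiftSeq L (M + 1) n) * (A₁.toReal * (δ n).toReal) + A₀.toReal ^ 2 := by
    intro n hn
    have hn' := hfin n hn.le
    have h1 := hη n
    have h2 := ENNReal.toReal_mono (by finiteness) (h n hn)
    rwa [ENNReal.toReal_add (by finiteness) (by finiteness),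
      ENNReal.toReal_add (by finiteness) (by finiteness), ENNReal.toReal_mul, ENNReal.toReal_mul,
      ENNReal.toReal_mul, ENNReal.toReal_pow, ENNReal.toReal_pow, ENNReal.toReal_pow,
      ENNReal.toReal_ofReal (by positivity), ENNReal.toReal_ofReal (by positivity)] at h2
  have hE := ENNReal.ofReal_le_ofReal (energy_le hL M
    (d := fun n => (δ n).toReal) hreal)
  have hlhs : ∑ n ∈ Finset.range (M + 1), ENNReal.ofReal (shiftSeq L (M + 1) n ^ 2) * δ n ^ 2
      = ENNReal.ofReal (∑ n ∈ Finset.range (M + 1),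
          shiftSeq L (M + 1) n ^ 2 * (δ n).toReal ^ 2) := by
    rw [ENNReal.ofReal_sum_of_nonneg fun n _ => by positivity]
    refine Finset.sum_congr rfl fun n hn => ?_
    rw [ENNReal.ofReal_mul (sq_nonneg _), ENNReal.ofReal_pow ENNReal.toReal_nonneg,
      ← hofReal n (by have := Finset.mem_range.1 hn; omega)]
  rw [hlhs]
  refine hE.trans (le_of_eq ?_)
  rw [ENNReal.ofReal_mul (by norm_num), ENNReal.ofReal_add (by positivity) (by positivity),
    ENNReal.ofReal_add (by positivity) (by positivity), ENNReal.ofReal_mul hw.le,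
    ENNReal.ofReal_mul hm0.le, ENNReal.ofReal_mul hb.le, ENNReal.ofReal_pow ENNReal.toReal_nonneg,
    ENNReal.ofReal_pow ENNReal.toReal_nonneg, ENNReal.ofReal_pow ENNReal.toReal_nonneg,
    ENNReal.ofReal_toReal hW, ENNReal.ofReal_toReal hA₀, ENNReal.ofReal_toReal hA₁]

/-- The costs in the divergence bound are controlled by the energy. -/
lemma sum_cost_le {M : ℕ} {η : ℕ → ℝ} (hη : η M = 1) {c c' : ℝ} (hc : 0 ≤ c) (hc' : 0 ≤ c')
    (D : ℕ → ℝ≥0∞) :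
    ∑ k ∈ Finset.range M, ENNReal.ofReal (c * η k ^ 2) * D k + ENNReal.ofReal c' * D M ≤
      ENNReal.ofReal (c + c') *
        ∑ k ∈ Finset.range (M + 1), ENNReal.ofReal (η k ^ 2) * D k := by
  -- Because η at M is 1, the unweighted final cost is the last term of the energy.
  rw [Finset.sum_range_succ, mul_add, Finset.mul_sum, hη, one_pow, ENNReal.ofReal_one, one_mul]
  refine add_le_add (Finset.sum_le_sum fun k _ => ?_)
    (mul_le_mul' (ENNReal.ofReal_le_ofReal (by linarith)) le_rfl)
  rw [ENNReal.ofReal_mul hc, mul_assoc]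
  exact mul_le_mul' (ENNReal.ofReal_le_ofReal (by linarith)) le_rfl

theorem mainTheorem3 :
    ∃ C : ℝ, 0 < C ∧
      ∀ (L : ℝ) (N : ℕ), L ∈ Set.Icc (1 / 2 : ℝ) 2 → 1 ≤ N →
      ∃ η : ℕ → ℝ, (∀ n, η n ∈ Set.Icc (0 : ℝ) 1) ∧ η (N - 1) = 1 ∧
      ∀ (d : ℕ) (Phat P : Kernel (Euc d) (Euc d)) [IsMarkovKernel Phat] [IsMarkovKernel P]
        (μ ν : Measure (Euc d)) [IsProbabilityMeasure μ] [IsProbabilityMeasure ν]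
        (a₀ b : Euc d → ℝ) (a₁ : Euc d → Euc d → ℝ) (c c' : ℝ),
        MemLp id 2 μ → MemLp id 2 ν →
        Measurable a₀ → Measurable b → Measurable (Function.uncurry a₁) →
        (∀ x, 0 ≤ a₀ x) → (∀ x, 0 ≤ b x) → (∀ x y, 0 ≤ a₁ x y) → 0 ≤ c → 0 ≤ c' →
        (∀ x y, W2 (Phat x) (P y) ^ 2 ≤
          ENNReal.ofReal (L ^ 2 * ‖x - y‖ ^ 2 + 2 * a₁ x y * ‖x - y‖ + a₀ x ^ 2)) →
        (∀ x y, klDiv (P x) (P y) ≤ ENNReal.ofReal (c * ‖x - y‖ ^ 2)) →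
        (∀ x y, klDiv (Phat x) (P y) ≤ ENNReal.ofReal (c' * ‖x - y‖ ^ 2 + b x ^ 2)) →
        (∃ γ, IsShiftedProcess Phat P μ ν N η γ) ∧
        ∀ γ, IsShiftedProcess Phat P μ ν N η γ →
          klDiv (iterLaw μ Phat N) (iterLaw ν P N) ≤
            ENNReal.ofReal C *
              (ENNReal.ofReal (c + c') *
                  (ENNReal.ofReal (wCoeff L N) * W2 μ ν ^ 2
                    + ENNReal.ofReal (max ((L - 1) * N) (Real.log (barN L N)))
                        * supL2 Phat μ N a₀ ^ 2
                    + ENNReal.ofReal (barN L N) * supShiftedL2 N η γ a₁ ^ 2)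
                + supL2 Phat μ N b ^ 2) := by
  -- The 16 comes from the A₁ term for L < 1: the factor 4 r² with r ≤ 2.
  refine ⟨16, by norm_num, fun L N hL hN => ⟨shiftSeq L N, shiftSeq_mem (by linarith [hL.1]) N,
    shiftSeq_last L hN, ?_⟩⟩
  intro d Phat P _ _ μ ν _ _ a₀ b a₁ c c' _ _ ha₀ hb ha₁ _ _ ha₁0 hc hc' hW hKL hKL'
  refine ⟨exists_isShiftedProcess Phat P μ ν N _, fun γ hγ => ?_⟩
  obtain ⟨M, rfl⟩ := Nat.exists_eq_add_of_le' hN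
  have henergy := ennreal_energy_le hL.1 M (δ := fun n => rmsDist (γ n))
    (A₀ := supL2 Phat μ (M + 1) a₀) (A₁ := supShiftedL2 (M + 1) (shiftSeq L (M + 1)) γ a₁)
    fun n hn => rmsDist_succ_sq_le hγ (by omega) (shiftSeq_mem (by linarith [hL.1]) _ n)
      ha₀ ha₁ ha₁0 hW
  simp only [rmsDist_sq, hγ.init.quadCost_eq] at henergy
  have hcost := sum_cost_le (η := shiftSeq L (M + 1)) (shiftSeq_last L hN) hc hc'
    fun k => quadCost (γ k)
  refine (klDiv_iterLaw_le hγ hc' hb hKL hKL').trans ?_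
  rw [← add_assoc, mul_add]
  refine add_le_add (hcost.trans ((mul_le_mul' le_rfl henergy).trans (le_of_eq ?_))) ?_
  · rw [mul_left_comm]
  · exact le_mul_of_one_le_left' (by simp)
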